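/- Let $\mathbf{H}$ be a real separable Hilbert space with norm $|\cdot|$ and inner product $(\cdot,\cdot)$, and let $Y$ be an $\mathbf{H}$-valued Gaussian random element with zero mean and covariance operator $V$, i.e. $(Vx,z)=\mathbf{E}(Y,x)(Y,z)$. Let $e_1,e_2,\dots$ be a complete orthonormal system of eigenvectors of $V$, $Ve_i=\sigma_i^2e_i$ with $\sigma_i\ge 0$, numbered so that $$\sigma_1^2=\cdots=\sigma_k^2>\sigma_j^2\quad (j>k),\qquad \sigma_1>0,$$ so that $k$ is the multiplicity of the largest eigenvalue $\sigma_1^2$, and let $\sigma_{k+1}^2$ denote the largest of the remaining eigenvalues ($0$ if there are none). Suppose that $k\ge 3$. For $a\in\mathbf{H}$ put $$a_i=(a,e_i),\quad Y_i=(Y,e_i),\quad |\overline a_k|^2=\sum_{i=1}^k a_i^2,\quad R=\sum_{j>k}(Y_j-a_j)^2,\quad u_0=2k\Big(1-\frac{\sigma_{k+1}^2}{\sigma_1^2}\Big)^{-2}\mathbf{E}R .$$ Then $|Y-a|^2$ and $\sum_{i=1}^k(Y_i-a_i)^2$ have continuous densities $p(u,a)$ and $f_k(u,a)$, $u\in\mathbb{R}$,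 respectively, and the following holds. a) For all $u\ge 0$ and $a\in\mathbf{H}$, $$p(u,a)\le f_k(u,a)\,\mathbf{E}\exp\Big\{\frac{R}{2\sigma_1^2}\Big\},$$ where $$\mathbf{E}\exp\Big\{\frac{R}{2\sigma_1^2}\Big\}=\prod_{j>k}\Big(1-\frac{\sigma_j^2}{\sigma_1^2}\Big)^{-1/2}\exp\Big\{\frac{a_j^2}{2(\sigma_1^2-\sigma_j^2)}\Big\}<\infty .$$ b) If either i) $k=3$ and $u\ge u^*=4.9\,u_0+16.94\,|\overline a_3|^2\sigma_1^{-4}u_0^2$, or ii) $k\ge 4$ and $u\ge u^{**}=5.625\,(k-1)^2(k-3)^{-1}u_0+16\,|\overline a_k|^2\sigma_1^{-4}u_0^2(k-3)^{-2}$, then $$p(u,a)\ge 0.125\,f_k(u,a)\,\mathbf{E}\exp\Big\{\frac{R}{2\sigma_1^2}\Big\}.$$ -/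

import Mathlib

open MeasureTheory ProbabilityTheory

noncomputable section

/-- `p` is the continuous density of the real random variable `X` with respect to Lebesgue measure.
A continuous density is unique, so its value at each single point is determined by the law
of `X`. -/
structure IsContinuousDensity {Ω : Type*} [MeasurableSpace Ω] (P : Measure Ω)
    (X : Ω → ℝ) (p : ℝ → ℝ) : Prop where
  aemeasurable : AEMeasurable X P
  continuous : Continuous p
  nonneg : ∀ u, 0 ≤ p u
  map_eq : P.map X = volume.withDensity (fun u => ENNReal.ofReal (p u))

/-- `e` is an orthonormal basis of eigenvectors of the covariance operator of (the law of) `Y`, and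
`σ i ^ 2` is the eigenvalue belonging to `e i`. -/
structure IsCovarianceEigenbasis {Ω : Type*} [MeasurableSpace Ω] (P : Measure Ω)
    {H : Type*} [NormedAddCommGroup H] [InnerProductSpace ℝ H] [CompleteSpace H]
    [MeasurableSpace H] [BorelSpace H] (Y : Ω → H)
    {ι : Type*} (e : HilbertBasis ι ℝ H) (σ : ι → ℝ) : Prop where
  nonneg : ∀ i, 0 ≤ σ i
  eigen : ∀ i, covarianceOperator (P.map Y) (e i) = (σ i ^ 2) • e i

/-- The largest eigenvalue is `σ₁ ^ 2`, it is positive, and its multiplicity is `k`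
(for `k ≠ 0`; `Set.ncard` of an infinite set is `0`). -/
structure IsTopEigenvalue {ι : Type*} (σ : ι → ℝ) (σ₁ : ℝ) (k : ℕ) : Prop where
  pos : 0 < σ₁
  le : ∀ i, σ i ≤ σ₁
  multiplicity : {i | σ i = σ₁}.ncard = k

/-- The sum of `x_i ^ 2` over the indices `i` of the top eigenvalue, where `x_i = (x, e_i)`;
in the usual enumeration `x_1 ^ 2 + ⋯ + x_k ^ 2`. -/
def topSq {H : Type*} [NormedAddCommGroup H] [InnerProductSpace ℝ H]
    {ι : Type*} (e : HilbertBasis ι ℝ H) (σ : ι → ℝ) (σ₁ : ℝ) (x : H) : ℝ :=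
  ∑' i : {i // σ i = σ₁}, (inner ℝ (e i) x) ^ 2

/-- The sum of `x_j ^ 2` over all the other indices; in the usual enumeration
the sum over `j ≥ k + 1`. -/
def restSq {H : Type*} [NormedAddCommGroup H] [InnerProductSpace ℝ H]
    {ι : Type*} (e : HilbertBasis ι ℝ H) (σ : ι → ℝ) (σ₁ : ℝ) (x : H) : ℝ :=
  ∑' j : {j // σ j ≠ σ₁}, (inner ℝ (e j) x) ^ 2

/-- `σ_{k+1}`, the largest of the remaining `σ j`; it is `0` if there are none. -/
def nextSigma {ι : Type*} (σ : ι → ℝ) (σ₁ : ℝ) : ℝ :=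
  ⨆ j : {j // σ j ≠ σ₁}, σ j

/-- The random variable `R`, the sum of `(Y_j - a_j) ^ 2` over the indices outside the top
eigenvalue. -/
def remainder {Ω : Type*} {H : Type*} [NormedAddCommGroup H] [InnerProductSpace ℝ H] (Y : Ω → H)
    {ι : Type*} (e : HilbertBasis ι ℝ H) (σ : ι → ℝ) (σ₁ : ℝ) (a : H) (ω : Ω) : ℝ :=
  restSq e σ σ₁ (Y ω - a)

/-- `E exp (R / (2 σ₁²))`. -/
def expMoment {Ω : Type*} [MeasurableSpace Ω] (P : Measure Ω)
    {H : Type*} [NormedAddCommGroup H] [InnerProductSpace ℝ H] (Y : Ω → H)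
    {ι : Type*} (e : HilbertBasis ι ℝ H) (σ : ι → ℝ) (σ₁ : ℝ) (a : H) : ℝ :=
  ∫ ω, Real.exp (remainder Y e σ σ₁ a ω / (2 * σ₁ ^ 2)) ∂P

/-- `u₀ = 2 k (1 - σ_{k+1}² / σ₁²)⁻² E R`. -/
def uZero {Ω : Type*} [MeasurableSpace Ω] (P : Measure Ω)
    {H : Type*} [NormedAddCommGroup H] [InnerProductSpace ℝ H] (Y : Ω → H)
    {ι : Type*} (e : HilbertBasis ι ℝ H) (σ : ι → ℝ) (σ₁ : ℝ) (k : ℕ) (a : H) : ℝ :=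
  2 * k * ((1 - nextSigma σ σ₁ ^ 2 / σ₁ ^ 2) ^ 2)⁻¹ * ∫ ω, remainder Y e σ σ₁ a ω ∂P

/-- The threshold `u*`, for `k = 3`; `topSq e σ σ₁ a` is then `a_1² + a_2² + a_3²`. -/
def uStar {Ω : Type*} [MeasurableSpace Ω] (P : Measure Ω)
    {H : Type*} [NormedAddCommGroup H] [InnerProductSpace ℝ H] (Y : Ω → H)
    {ι : Type*} (e : HilbertBasis ι ℝ H) (σ : ι → ℝ) (σ₁ : ℝ) (k : ℕ) (a : H) : ℝ :=
  4.9 * uZero P Y e σ σ₁ k a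
    + 16.94 * topSq e σ σ₁ a * (σ₁ ^ 4)⁻¹ * uZero P Y e σ σ₁ k a ^ 2

/-- The threshold `u**`, for `k ≥ 4`; `topSq e σ σ₁ a` is then `a_1² + ⋯ + a_k²`. -/
def uStarStar {Ω : Type*} [MeasurableSpace Ω] (P : Measure Ω)
    {H : Type*} [NormedAddCommGroup H] [InnerProductSpace ℝ H] (Y : Ω → H)
    {ι : Type*} (e : HilbertBasis ι ℝ H) (σ : ι → ℝ) (σ₁ : ℝ) (k : ℕ) (a : H) : ℝ :=
  5.625 * ((k : ℝ) - 1) ^ 2 * ((k : ℝ) - 3)⁻¹ * uZero P Y e σ σ₁ k a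
    + 16 * topSq e σ σ₁ a * (σ₁ ^ 4)⁻¹ * uZero P Y e σ σ₁ k a ^ 2 * (((k : ℝ) - 3) ^ 2)⁻¹

end

/-! Write `|Y - a|²` as `X + R`, with `X` the sum over the top eigenspace. Uncorrelated Gaussian
coordinates are independent, so `p(u) = E f(u - R)`, where `f` is the density of `X`, and everything
reduces to comparing `f(u - r)` with `f(u)`. In polar coordinates, with `n = k - 2` and `v = σ₁²`,
`f(u)` is a constant times `√u ^ n * exp (-u / (2v)) * G(√u)`, where `G(x)` integrates `cosh (x ⟪b /
v, θ⟫)` over the unit sphere and `b` is the mean vector. Since `G` increases, `f(u - r) ≤ f(u) exp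
(r / (2v))`; averaging over `R` gives the upper bound. For the lower bound, `exp (-s x) G(x)`
decreases for `s = ‖b / v‖`. With Bernoulli's inequality this yields `f(u - r) ≥ f(u) exp (r / (2v))
(2 - exp (K r))`, where `K = n / u + s / √u` (`le_radialProfile_sub`). Averaging leaves `2 E exp
(tR) - E exp ((t + K) R)` with `t = 1 / (2v)`. The explicit Gaussian formula shows that the second
moment is at most `exp (1/2) ≤ 15/8` times `E exp (tR)` once `K (1 - q)⁻² E R ≤ 1/4`, where `q =
σ_{k+1}² / σ₁²` (`exp_moment_remainder_add_le`). The thresholds on `u` ensure this, and `2 - 15/8 =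
0.125`. -/

noncomputable section

open Filter Topology
open scoped NNReal ENNReal

/-! ### Exponential moments of the square of one Gaussian variable. -/

/-- The logarithm of `E exp (t X ^ 2)` for a Gaussian variable `X` with mean `m` and variance `v`. -/
def logMgfSq (t m v : ℝ) : ℝ :=
  -(1 / 2) * Real.log (1 - 2 * t * v) + t * m ^ 2 / (1 - 2 * t * v)

lemma exp_logMgfSq {t m v : ℝ} (h : 2 * t * v < 1) :
    Real.exp (logMgfSq t m v) =
      (1 - 2 * t * v) ^ (-(1 / 2) : ℝ) * Real.exp (t * m ^ 2 / (1 - 2 * t * v)) := by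
  rw [logMgfSq, Real.exp_add, Real.rpow_def_of_pos (by linarith), mul_comm (Real.log _)]

/-- Completing the square: tilting by `exp (t x²)` turns a Gaussian density into a multiple of
another one, with mean and variance both divided by `1 - 2tv`. -/
lemma exp_mul_gaussianPDFReal {t m : ℝ} {v w : ℝ≥0} (hv : v ≠ 0) (h : 2 * t * v < 1)
    (hw : (w : ℝ) = v / (1 - 2 * t * v)) (x : ℝ) :
    gaussianPDFReal m v x * Real.exp (t * x ^ 2) =
      Real.exp (logMgfSq t m v) * gaussianPDFReal (m / (1 - 2 * t * v)) w x := by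
  have h0 : 0 < 1 - 2 * t * v := by linarith
  have hv' : (0 : ℝ) < v := by positivity
  rw [exp_logMgfSq h, gaussianPDFReal, gaussianPDFReal, hw, Real.rpow_neg h0.le,
    ← Real.sqrt_eq_rpow]
  obtain ⟨A, hA⟩ : ∃ A, A = 1 - 2 * t * v := ⟨_, rfl⟩
  have ht : t = (1 - A) / (2 * v) := by rw [hA]; field_simp; ring
  rw [← hA] at h0 ⊢
  rw [mul_div_assoc', Real.sqrt_div' _ h0.le, inv_div]
  have h1 : √A ≠ 0 := (Real.sqrt_pos.2 h0).ne'
  have h2 : √(2 * Real.pi * v) ≠ 0 := (Real.sqrt_pos.2 (by positivity)).ne'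
  have : Real.exp (-(x - m) ^ 2 / (2 * v)) * Real.exp (t * x ^ 2) =
      Real.exp (t * m ^ 2 / A) * Real.exp (-(x - m / A) ^ 2 / (2 * (v / A))) := by
    rw [← Real.exp_add, ← Real.exp_add]
    congr 1
    rw [ht]
    field_simp
    ring
  rw [mul_assoc, this]
  field_simp

lemma lintegral_exp_sq_gaussianReal {t m : ℝ} {v : ℝ≥0} (h : 2 * t * v < 1) :
    ∫⁻ x, ENNReal.ofReal (Real.exp (t * x ^ 2)) ∂(gaussianReal m v) =
      ENNReal.ofReal (Real.exp (logMgfSq t m v)) := by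
  rcases eq_or_ne v 0 with rfl | hv
  · rw [gaussianReal_zero_var, lintegral_dirac]
    simp [logMgfSq]
  · have h0 : 0 < 1 - 2 * t * v := by linarith
    obtain ⟨w, hw⟩ : ∃ w : ℝ≥0, (w : ℝ) = v / (1 - 2 * t * v) := ⟨⟨_, by positivity⟩, rfl⟩
    have hw0 : w ≠ 0 := by
      rw [← NNReal.coe_ne_zero, hw]
      exact div_ne_zero (NNReal.coe_ne_zero.2 hv) h0.ne'
    rw [gaussianReal_of_var_ne_zero _ hv,
      lintegral_withDensity_eq_lintegral_mul _ (measurable_gaussianPDF _ _) (by fun_prop)]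
    simp_rw [Pi.mul_apply, gaussianPDF, ← ENNReal.ofReal_mul (gaussianPDFReal_nonneg _ _ _),
      exp_mul_gaussianPDFReal hv h hw, ENNReal.ofReal_mul (Real.exp_nonneg _)]
    rw [lintegral_const_mul _ (by fun_prop), lintegral_gaussianPDFReal_eq_one _ hw0, mul_one]

lemma neg_log_one_sub_le {x : ℝ} (hx : x < 1) : -Real.log (1 - x) ≤ x / (1 - x) := by
  have h : 0 < 1 - x := by linarith
  have := Real.one_sub_inv_le_log_of_pos h
  have h2 : 1 - (1 - x)⁻¹ = - (x / (1 - x)) := by field_simp; ring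
  linarith

lemma logMgfSq_nonneg {t m v : ℝ} (ht : 0 ≤ t) (hv : 0 ≤ v) (h : 2 * t * v < 1) :
    0 ≤ logMgfSq t m v := by
  have h0 : 0 < 1 - 2 * t * v := by linarith
  have h1 : Real.log (1 - 2 * t * v) ≤ 0 :=
    Real.log_nonpos h0.le (by nlinarith [mul_nonneg ht hv])
  have h2 : 0 ≤ t * m ^ 2 / (1 - 2 * t * v) := by positivity
  rw [logMgfSq]
  linarith

/-- The logarithmic moment generating function of `X ^ 2` grows at most linearly as long as
the increment of the parameter is small. -/
lemma logMgfSq_add_le {t δ m v q : ℝ} (hδ : 0 ≤ δ) (ht : 0 ≤ t) (hv : 0 ≤ v) (hq : q < 1)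
    (h : 2 * t * v ≤ q) (h2 : 4 * δ * v ≤ 1 - q) :
    logMgfSq (t + δ) m v ≤ logMgfSq t m v + 2 * δ * ((1 - q) ^ 2)⁻¹ * (v + m ^ 2) := by
  set A := 1 - 2 * t * v with hA
  have hqA : 1 - q ≤ A := by linarith
  have hq0 : 0 < 1 - q := by linarith
  have hA0 : 0 < A := by linarith
  have hA1 : A ≤ 1 := by nlinarith [mul_nonneg ht hv]
  have hB : 1 - 2 * (t + δ) * v = A - 2 * δ * v := by rw [hA]; ring
  -- The increment `δ` uses up at most half of the gap `A`; this is where the factor 2 in the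
  -- conclusion comes from.
  have hB2 : A / 2 ≤ A - 2 * δ * v := by linarith
  have hB0 : 0 < A - 2 * δ * v := by linarith
  have hδv : 0 ≤ δ * v := mul_nonneg hδ hv
  have e1 : (1 - q) ^ 2 ≤ A ^ 2 := by gcongr
  have hi : (A ^ 2)⁻¹ ≤ ((1 - q) ^ 2)⁻¹ := by gcongr
  have key1 : -(1 / 2) * Real.log (A - 2 * δ * v) + (1 / 2) * Real.log A
      ≤ 2 * δ * v * (A ^ 2)⁻¹ := by
    have e : A - 2 * δ * v = A * (1 - 2 * δ * v / A) := by field_simp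
    have hy : 2 * δ * v / A ≤ 1 / 2 := by rw [div_le_iff₀ hA0]; linarith
    have hy0 : 0 ≤ 2 * δ * v / A := by positivity
    rw [e, Real.log_mul hA0.ne' (by linarith)]
    have := neg_log_one_sub_le (x := 2 * δ * v / A) (by linarith)
    have l2 : 2 * δ * v / A / (1 - 2 * δ * v / A) ≤ 2 * (2 * δ * v / A) := by
      rw [div_le_iff₀ (by linarith)]; nlinarith
    have l3 : 2 * δ * v / A ≤ 2 * δ * v * (A ^ 2)⁻¹ := by
      rw [div_eq_mul_inv]
      gcongr
      nlinarith
    linarith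
  have key2 : (t + δ) * m ^ 2 / (A - 2 * δ * v) - t * m ^ 2 / A ≤ 2 * δ * m ^ 2 * (A ^ 2)⁻¹ := by
    have e : (t + δ) * m ^ 2 / (A - 2 * δ * v) - t * m ^ 2 / A =
        δ * m ^ 2 / (A * (A - 2 * δ * v)) := by
      rw [div_sub_div _ _ hB0.ne' hA0.ne', mul_comm A]
      congr 1
      rw [hA]; ring
    rw [e, div_eq_mul_inv]
    have : (A * (A - 2 * δ * v))⁻¹ ≤ (A ^ 2 / 2)⁻¹ := by
      gcongr
      nlinarith
    calc δ * m ^ 2 * (A * (A - 2 * δ * v))⁻¹ ≤ δ * m ^ 2 * (A ^ 2 / 2)⁻¹ := by gcongr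
      _ = _ := by rw [inv_div]; ring
  have key3 : 2 * δ * (v + m ^ 2) * (A ^ 2)⁻¹ ≤ 2 * δ * (v + m ^ 2) * ((1 - q) ^ 2)⁻¹ := by
    gcongr
  rw [logMgfSq, logMgfSq, hB, ← hA]
  linarith

/-- The uniform gap `1 - q` bounds each term by `t (1 - q)⁻¹ (v i + m i ^ 2)`. -/
lemma summable_logMgfSq {ι : Type*} {m v : ι → ℝ} {t q : ℝ} (ht : 0 ≤ t) (hv : ∀ i, 0 ≤ v i)
    (hq : q < 1) (h : ∀ i, 2 * t * v i ≤ q) (hs : Summable v) (hm : Summable fun i => m i ^ 2) :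
    Summable fun i => logMgfSq t (m i) (v i) := by
  refine Summable.of_nonneg_of_le
    (fun i => logMgfSq_nonneg ht (hv i) ((h i).trans_lt hq)) (fun i => ?_)
    ((hs.mul_left (t * (1 - q)⁻¹)).add (hm.mul_left (t * (1 - q)⁻¹)))
  have h0 : 0 < 1 - 2 * t * v i := by linarith [h i]
  have hq0 : 0 < 1 - q := by linarith
  have hi : (1 - 2 * t * v i)⁻¹ ≤ (1 - q)⁻¹ := by
    gcongr
    exact h i
  have h1 := neg_log_one_sub_le (x := 2 * t * v i) (by linarith)
  have h2 : 2 * t * v i / (1 - 2 * t * v i) ≤ 2 * t * v i * (1 - q)⁻¹ := by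
    rw [div_eq_mul_inv]
    have := hv i
    gcongr
  have h3 : t * m i ^ 2 / (1 - 2 * t * v i) ≤ t * m i ^ 2 * (1 - q)⁻¹ := by
    rw [div_eq_mul_inv]
    gcongr
  rw [logMgfSq]
  linarith

/-! ### Exponential moments of countable sums of independent squares. -/

section SumOfSquares

variable {Ω : Type*} [MeasurableSpace Ω] {P : Measure Ω} {ι : Type*} {Z : ι → Ω → ℝ}
  {m : ι → ℝ} {v : ι → ℝ≥0}

lemma lintegral_exp_finset_sum_sq (hZ : iIndepFun Z P)
    (hlaw : ∀ i, HasLaw (Z i) (gaussianReal (m i) (v i)) P) {t : ℝ} (h : ∀ i, 2 * t * v i < 1)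
    (s : Finset ι) :
    ∫⁻ ω, ENNReal.ofReal (Real.exp (t * ∑ i ∈ s, Z i ω ^ 2)) ∂P =
      ENNReal.ofReal (Real.exp (∑ i ∈ s, logMgfSq t (m i) (v i))) := by
  have : IsProbabilityMeasure P := hZ.isProbabilityMeasure
  obtain ⟨Z', hZ'm, hZ'⟩ : ∃ Z' : ι → Ω → ℝ, (∀ i, Measurable (Z' i)) ∧ ∀ i, Z i =ᵐ[P] Z' i :=
    ⟨fun i => (hlaw i).aemeasurable.mk _, fun i => (hlaw i).aemeasurable.measurable_mk,
      fun i => (hlaw i).aemeasurable.ae_eq_mk⟩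
  have hind : iIndepFun (fun i ω => ENNReal.ofReal (Real.exp (t * Z' i ω ^ 2))) P :=
    (hZ.congr hZ').comp (fun _ x => ENNReal.ofReal (Real.exp (t * x ^ 2))) (fun _ => by fun_prop)
  have e : ∀ᵐ ω ∂P, ENNReal.ofReal (Real.exp (t * ∑ i ∈ s, Z i ω ^ 2)) =
      ∏ i ∈ s, ENNReal.ofReal (Real.exp (t * Z' i ω ^ 2)) := by
    have : ∀ᵐ ω ∂P, ∀ i ∈ s, Z i ω = Z' i ω := (Finset.eventually_all s).2 fun i _ => hZ' i
    filter_upwards [this] with ω hω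
    rw [Finset.sum_congr rfl fun i hi => by rw [hω i hi], Finset.mul_sum, Real.exp_sum,
      ENNReal.ofReal_prod_of_nonneg fun _ _ => Real.exp_nonneg _]
  rw [lintegral_congr_ae e, lintegral_prod_eq_prod_lintegral_of_indepFun s _ hind
    (fun i => by have := hZ'm i; fun_prop), Real.exp_sum,
    ENNReal.ofReal_prod_of_nonneg fun _ _ => Real.exp_nonneg _]
  refine Finset.prod_congr rfl fun i _ => ?_
  have hl : HasLaw (Z' i) (gaussianReal (m i) (v i)) P := (hlaw i).congr (hZ' i).symm
  rw [← lintegral_exp_sq_gaussianReal (h i), ← hl.map_eq,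
    lintegral_map (by fun_prop) (hZ'm i)]

/-- Monotone convergence along finite sets exhausting `ι`; `0 ≤ t` makes the partial exponentials
increase. -/
lemma lintegral_exp_sum_sq [Countable ι] (hZ : iIndepFun Z P)
    (hlaw : ∀ i, HasLaw (Z i) (gaussianReal (m i) (v i)) P) {t : ℝ} (ht : 0 ≤ t)
    (h : ∀ i, 2 * t * v i < 1) {R : Ω → ℝ} (hR : ∀ ω, HasSum (fun i => Z i ω ^ 2) (R ω))
    {L : ℝ} (hL : HasSum (fun i => logMgfSq t (m i) (v i)) L) :
    ∫⁻ ω, ENNReal.ofReal (Real.exp (t * R ω)) ∂P = ENNReal.ofReal (Real.exp L) := by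
  obtain ⟨s, hs, hst⟩ := exists_seq_monotone_tendsto_atTop_atTop (Finset ι)
  have hlim : Tendsto (fun n => ∫⁻ ω, ENNReal.ofReal (Real.exp (t * ∑ i ∈ s n, Z i ω ^ 2)) ∂P)
      atTop (𝓝 (∫⁻ ω, ENNReal.ofReal (Real.exp (t * R ω)) ∂P)) := by
    refine lintegral_tendsto_of_tendsto_of_monotone (fun n => ?_) (ae_of_all _ fun ω => ?_)
      (ae_of_all _ fun ω => ?_)
    · have := fun i => (hlaw i).aemeasurable
      fun_prop
    · intro a b hab
      dsimp only
      gcongr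
      exact hs hab
    · refine (ENNReal.continuous_ofReal.tendsto _).comp
        ((Real.continuous_exp.tendsto _).comp (Tendsto.const_mul _ ?_))
      exact (hR ω).comp hst
  simp_rw [lintegral_exp_finset_sum_sq hZ hlaw h] at hlim
  refine tendsto_nhds_unique hlim ((ENNReal.continuous_ofReal.tendsto _).comp
    ((Real.continuous_exp.tendsto _).comp ?_))
  exact Tendsto.comp (g := fun s : Finset ι => ∑ i ∈ s, logMgfSq t (m i) (v i)) hL hst

end SumOfSquares

/-! ### The law of the squared norm, by polar coordinates. -/

section Polar

open Set Metric Module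

variable {E : Type*} [NormedAddCommGroup E] [NormedSpace ℝ E]
  [FiniteDimensional ℝ E] [MeasurableSpace E] [BorelSpace E]

/-- Integration in polar coordinates. -/
lemma lintegral_polar [Nontrivial E] (μ : Measure E) [μ.IsAddHaarMeasure]
    {φ : E → ℝ≥0∞} (hφ : Measurable φ) :
    ∫⁻ x, φ x ∂μ = ∫⁻ r in Ioi (0 : ℝ), ENNReal.ofReal (r ^ (finrank ℝ E - 1)) *
      ∫⁻ θ, φ (r • (θ : E)) ∂μ.toSphere := by
  have h1 : ∫⁻ x, φ x ∂μ = ∫⁻ x : ({(0)}ᶜ : Set E), φ x.1 ∂(μ.comap (↑)) := by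
    rw [lintegral_subtype_comap (measurableSet_singleton _).compl,
      restrict_compl_singleton]
  have h2 := (μ.measurePreserving_homeomorphUnitSphereProd).lintegral_comp_emb
    (Homeomorph.measurableEmbedding _) (fun p => φ (p.2.1 • (p.1 : E)))
  rw [h1]
  have h3 : ∀ x : ({(0)}ᶜ : Set E),
      φ x.1 = φ ((homeomorphUnitSphereProd E x).2.1 • ((homeomorphUnitSphereProd E x).1 : E)) := by
    intro x
    have hx : ‖(x : E)‖ ≠ 0 := norm_ne_zero_iff.2 x.2
    simp [smul_smul, mul_inv_cancel₀ hx]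
  rw [lintegral_congr h3, h2, lintegral_prod_symm _ (by fun_prop), Measure.volumeIoiPow,
    lintegral_withDensity_eq_lintegral_mul _ (by fun_prop)]
  · rw [← lintegral_subtype_comap measurableSet_Ioi]
    rfl
  · exact Measurable.lintegral_prod_left' (f := fun p : (sphere (0 : E) 1) × Ioi (0 : ℝ) =>
      φ (p.2.1 • (p.1 : E))) (by fun_prop)

lemma lintegral_Ioi_comp_sq (g : ℝ → ℝ≥0∞) :
    ∫⁻ r in Ioi (0 : ℝ), ENNReal.ofReal (2 * r) * g (r ^ 2) = ∫⁻ u in Ioi (0 : ℝ), g u := by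
  have himg : (fun r : ℝ => r ^ 2) '' Ioi 0 = Ioi 0 := by
    ext u
    constructor
    · rintro ⟨r, hr, rfl⟩
      exact pow_pos (mem_Ioi.1 hr) 2
    · intro hu
      exact ⟨√u, Real.sqrt_pos.2 hu, Real.sq_sqrt (le_of_lt hu)⟩
  have := lintegral_image_eq_lintegral_deriv_mul_of_monotoneOn (s := Ioi (0 : ℝ))
    (f := fun r => r ^ 2) (f' := fun r => 2 * r) measurableSet_Ioi
    (fun x _ => by simpa using (hasDerivAt_pow 2 x).hasDerivWithinAt)
    (fun a ha b _ hab => pow_le_pow_left₀ (le_of_lt ha) hab 2) g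
  rw [← this, himg]

/-- The density of the squared norm of a random vector with density `q`. -/
lemma map_norm_sq_withDensity [Nontrivial E] (μ : Measure E) [μ.IsAddHaarMeasure] (hd : 3 ≤ finrank ℝ E)
    {q : E → ℝ≥0∞} (hq : Measurable q) :
    (μ.withDensity q).map (fun x => ‖x‖ ^ 2) = volume.withDensity (fun u =>
      ENNReal.ofReal (1 / 2 * √u ^ (finrank ℝ E - 2)) * ∫⁻ θ, q (√u • (θ : E)) ∂μ.toSphere) := by
  have hmeas : Measurable fun r : ℝ => ∫⁻ θ, q (r • (θ : E)) ∂μ.toSphere :=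
    Measurable.lintegral_prod_right' (f := fun p : ℝ × (sphere (0 : E) 1) => q (p.1 • (p.2 : E)))
      (by fun_prop)
  ext s hs
  have hf : Measurable (s.indicator (1 : ℝ → ℝ≥0∞)) := measurable_one.indicator hs
  rw [← lintegral_indicator_one hs, ← lintegral_indicator_one hs,
    lintegral_map hf (by fun_prop),
    lintegral_withDensity_eq_lintegral_mul _ hq
      (show Measurable fun x : E => s.indicator (1 : ℝ → ℝ≥0∞) (‖x‖ ^ 2) from
        hf.comp (by fun_prop)),
    lintegral_withDensity_eq_lintegral_mul _ (by fun_prop) hf,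
    lintegral_polar μ (hq.mul (show Measurable fun x : E => s.indicator (1 : ℝ → ℝ≥0∞) (‖x‖ ^ 2) from
        hf.comp (by fun_prop)))]
  set ψ : ℝ → ℝ≥0∞ := s.indicator 1 with hψ
  -- For `u ≤ 0` one has `√u = 0`, and dimension at least 3 makes the exponent positive, so the
  -- proposed density vanishes there.
  have hsupp : Function.support ((fun u : ℝ => ENNReal.ofReal (1 / 2 * √u ^ (finrank ℝ E - 2)) *
      ∫⁻ θ, q (√u • (θ : E)) ∂μ.toSphere) * ψ) ⊆ Ioi 0 := by
    intro u hu
    by_contra hu0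
    refine hu ?_
    simp [Real.sqrt_eq_zero_of_nonpos (not_lt.1 hu0), zero_pow (show finrank ℝ E - 2 ≠ 0 by omega)]
  rw [← setLIntegral_eq_of_support_subset hsupp]
  refine Eq.trans ?_ (lintegral_Ioi_comp_sq _)
  refine setLIntegral_congr_fun measurableSet_Ioi fun r hr => ?_
  have hr : 0 < r := hr
  rw [Pi.mul_apply, Real.sqrt_sq hr.le]
  simp only [Pi.mul_apply]
  have e : ∀ θ : sphere (0 : E) 1, ‖r • (θ : E)‖ ^ 2 = r ^ 2 := fun θ => by
    rw [norm_smul, norm_eq_of_mem_sphere θ, mul_one, Real.norm_eq_abs, sq_abs]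
  simp_rw [e]
  rw [lintegral_mul_const _ (by fun_prop), ← mul_assoc, ← mul_assoc, ← mul_assoc,
    ← ENNReal.ofReal_mul (by positivity)]
  congr 4
  -- The Jacobians match: `r ^ (d - 1) = 2r * (1/2 * r ^ (d - 2))`.
  obtain ⟨n, hn⟩ : ∃ n, finrank ℝ E = n + 3 := ⟨_, (Nat.sub_add_cancel hd).symm⟩
  rw [hn, show n + 3 - 1 = n + 2 by omega, show n + 3 - 2 = n + 1 by omega]
  ring

/-- The norm is even, so only the even part of the density matters. For a shifted Gaussian this
replaces an exponential by a `cosh`, whose monotonicity in the radius is visible pointwise on the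
sphere. -/
lemma withDensity_map_norm_sq_symmetrize (μ : Measure E) [μ.IsAddHaarMeasure]
    {q : E → ℝ≥0∞} (hq : Measurable q) :
    (μ.withDensity q).map (fun x => ‖x‖ ^ 2) =
      (μ.withDensity (fun x => 2⁻¹ * (q x + q (-x)))).map (fun x => ‖x‖ ^ 2) := by
  ext s hs
  have hs' : MeasurableSet ((fun x : E => ‖x‖ ^ 2) ⁻¹' s) := by
    have : Measurable fun x : E => ‖x‖ ^ 2 := by fun_prop
    exact this hs
  rw [Measure.map_apply (by fun_prop) hs, Measure.map_apply (by fun_prop) hs,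
    withDensity_apply _ hs', withDensity_apply _ hs', lintegral_const_mul _ (by fun_prop),
    lintegral_add_left hq, ← lintegral_indicator hs', ← lintegral_indicator hs']
  have : ∫⁻ x, ((fun x : E => ‖x‖ ^ 2) ⁻¹' s).indicator (fun x => q (-x)) x ∂μ =
      ∫⁻ x, ((fun x : E => ‖x‖ ^ 2) ⁻¹' s).indicator q x ∂μ := by
    rw [← lintegral_neg_eq_self (μ := μ) (((fun x : E => ‖x‖ ^ 2) ⁻¹' s).indicator q)]
    refine lintegral_congr fun x => ?_
    by_cases hx : ‖x‖ ^ 2 ∈ s <;> simp [indicator, hx]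
  rw [this, ← two_mul, ← mul_assoc, ENNReal.inv_mul_cancel (by simp) (by simp), one_mul]

end Polar

/-! ### Density of a Gaussian vector with independent coordinates of equal variance. -/

section Pi

variable {T : Type*} [Fintype T]

lemma pi_gaussianReal_eq_withDensity (m : T → ℝ) {v : ℝ≥0} (hv : v ≠ 0) :
    Measure.pi (fun i => gaussianReal (m i) v) =
      volume.withDensity fun x => ENNReal.ofReal (∏ i, gaussianPDFReal (m i) v (x i)) := by
  refine Measure.pi_eq fun s hs => ?_
  have hnn : ∀ i x, 0 ≤ gaussianPDFReal (m i) v x := fun i x => gaussianPDFReal_nonneg _ _ _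
  rw [withDensity_apply _ (MeasurableSet.univ_pi hs), ← lintegral_indicator
    (MeasurableSet.univ_pi hs)]
  have hnn' : ∀ i x, 0 ≤ (s i).indicator (gaussianPDFReal (m i) v) x := fun i x =>
    Set.indicator_nonneg (fun _ _ => hnn _ _) _
  have e : ∀ x : T → ℝ, (Set.univ.pi s).indicator
      (fun x => ENNReal.ofReal (∏ i, gaussianPDFReal (m i) v (x i))) x =
      ENNReal.ofReal (∏ i, (s i).indicator (gaussianPDFReal (m i) v) (x i)) := by
    intro x
    by_cases hx : x ∈ Set.univ.pi s
    · rw [Set.indicator_of_mem hx]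
      congr 1
      exact Finset.prod_congr rfl fun i _ => (Set.indicator_of_mem (hx i trivial) _).symm
    · rw [Set.indicator_of_notMem hx]
      simp only [Set.mem_univ_pi, not_forall] at hx
      obtain ⟨i, hi⟩ := hx
      rw [Finset.prod_eq_zero (Finset.mem_univ i) (Set.indicator_of_notMem hi _),
        ENNReal.ofReal_zero]
  have hint : ∀ i, Integrable ((s i).indicator (gaussianPDFReal (m i) v)) := fun i =>
    (integrable_gaussianPDFReal _ _).indicator (hs i)
  rw [lintegral_congr e, volume_pi, ← ofReal_integral_eq_lintegral_ofReal
    (f := fun x : T → ℝ => ∏ i, (s i).indicator (gaussianPDFReal (m i) v) (x i))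
    (Integrable.fintype_prod hint) (ae_of_all _ fun x => Finset.prod_nonneg fun i _ => hnn' _ _),
    integral_fintype_prod_eq_prod,
    ENNReal.ofReal_prod_of_nonneg fun i _ => integral_nonneg (hnn' i)]
  refine Finset.prod_congr rfl fun i _ => ?_
  rw [gaussianReal_apply_eq_integral _ hv, integral_indicator (hs i)]

lemma prod_gaussianPDFReal (b x : EuclideanSpace ℝ T) (v : ℝ≥0) :
    ∏ i, gaussianPDFReal (b i) v (x i) =
      (√(2 * Real.pi * v))⁻¹ ^ Fintype.card T * Real.exp (-‖x - b‖ ^ 2 / (2 * v)) := by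
  simp_rw [gaussianPDFReal]
  rw [Finset.prod_mul_distrib, Finset.prod_const, Finset.card_univ, ← Real.exp_sum,
    EuclideanSpace.real_norm_sq_eq, ← Finset.sum_div, Finset.sum_neg_distrib]
  rfl

variable {Ω : Type*} [MeasurableSpace Ω] {P : Measure Ω}

lemma map_toLp_eq_withDensity {Z : T → Ω → ℝ} {b : EuclideanSpace ℝ T} {v : ℝ≥0} (hv : v ≠ 0)
    (hZ : iIndepFun Z P) (hlaw : ∀ i, HasLaw (Z i) (gaussianReal (b i) v) P) :
    P.map (fun ω => WithLp.toLp 2 (fun i => Z i ω)) = volume.withDensity fun x =>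
      ENNReal.ofReal ((√(2 * Real.pi * v))⁻¹ ^ Fintype.card T *
        Real.exp (-‖x - b‖ ^ 2 / (2 * v))) := by
  have := hZ.isProbabilityMeasure
  have hm : AEMeasurable (fun ω i => Z i ω) P := by
    have := fun i => (hlaw i).aemeasurable
    fun_prop
  have h1 : P.map (fun ω => WithLp.toLp 2 (fun i => Z i ω)) =
      (P.map (fun ω i => Z i ω)).map (WithLp.toLp 2) := by
    rw [AEMeasurable.map_map_of_aemeasurable (by fun_prop) hm]
    rfl
  rw [h1, (iIndepFun_iff_map_fun_eq_pi_map fun i => (hlaw i).aemeasurable).1 hZ]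
  simp_rw [fun i => (hlaw i).map_eq]
  rw [pi_gaussianReal_eq_withDensity _ hv]
  ext s hs
  have hvp := (EuclideanSpace.volume_preserving_symm_measurableEquiv_toLp T).symm
  rw [Measure.map_apply (by fun_prop) hs, withDensity_apply _ hs, withDensity_apply]
  swap
  · exact (show Measurable (WithLp.toLp 2 : (T → ℝ) → EuclideanSpace ℝ T) by fun_prop) hs
  have := (PiLp.volume_preserving_toLp T).setLIntegral_comp_preimage hs
    (f := fun x => ENNReal.ofReal ((√(2 * Real.pi * v))⁻¹ ^ Fintype.card T *
        Real.exp (-‖x - b‖ ^ 2 / (2 * v)))) (by fun_prop)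
  rw [← this]
  simp_rw [← prod_gaussianPDFReal]

end Pi

/-! ### Comparison of the radial profile at `u - r` and at `u`. -/

section RadialProfile

/-- The function `u ↦ √u ^ n * exp (-u / (2 v)) * G √u`, the form of the density of the squared norm
of a Gaussian vector. -/
def radialProfile (n : ℕ) (v : ℝ) (G : ℝ → ℝ) (u : ℝ) : ℝ :=
  √u ^ n * Real.exp (-u / (2 * v)) * G √u

variable {n : ℕ} {v : ℝ} {G : ℝ → ℝ}

lemma continuous_radialProfile (hG : Continuous G) : Continuous (radialProfile n v G) := by
  unfold radialProfile
  fun_prop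

lemma radialProfile_nonneg (hG : ∀ x, 0 ≤ x → 0 ≤ G x) (u : ℝ) : 0 ≤ radialProfile n v G u := by
  have := hG _ (Real.sqrt_nonneg u)
  unfold radialProfile
  positivity

lemma radialProfile_of_nonpos (hn : n ≠ 0) {u : ℝ} (hu : u ≤ 0) : radialProfile n v G u = 0 := by
  simp [radialProfile, Real.sqrt_eq_zero_of_nonpos hu, hn]

/-- The exponential factor gains exactly `exp (r / (2 * v))`, while the other two factors can only
shrink. -/
lemma radialProfile_sub_le (hG : ∀ x, 0 ≤ x → 0 ≤ G x) (hmono : MonotoneOn G (Set.Ici 0))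
    {u r : ℝ} (hr : 0 ≤ r) :
    radialProfile n v G (u - r) ≤ radialProfile n v G u * Real.exp (r / (2 * v)) := by
  have e : Real.exp (-(u - r) / (2 * v)) = Real.exp (-u / (2 * v)) * Real.exp (r / (2 * v)) := by
    rw [← Real.exp_add]; congr 1; ring
  have hs : √(u - r) ≤ √u := Real.sqrt_le_sqrt (by linarith)
  have hG1 := hmono (Set.mem_Ici.2 (Real.sqrt_nonneg (u - r))) (Set.mem_Ici.2 (Real.sqrt_nonneg u)) hs
  have hG0 := hG _ (Real.sqrt_nonneg (u - r))
  calc radialProfile n v G (u - r)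
      = Real.exp (-u / (2 * v)) * Real.exp (r / (2 * v)) * (√(u - r) ^ n * G √(u - r)) := by
        rw [radialProfile, e]; ring
    _ ≤ Real.exp (-u / (2 * v)) * Real.exp (r / (2 * v)) * (√u ^ n * G √u) := by gcongr
    _ = _ := by rw [radialProfile]; ring

/-- The power loses at most the factor `1 - n r / u` and `G` at most `1 - s r / √u`, so together at
most `1 - K r`. The weaker `2 - exp (K r)` is used because its average over `r` is an exponential
moment. -/
lemma le_radialProfile_sub (hn : 1 ≤ n) {s : ℝ} (hs : 0 ≤ s) (hG : ∀ x, 0 ≤ x → 0 ≤ G x)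
    (hanti : AntitoneOn (fun x => Real.exp (-(s * x)) * G x) (Set.Ici 0))
    {K u r : ℝ} (hu : 0 < u) (hr : 0 ≤ r) (hK : n / u + s / √u ≤ K) :
    radialProfile n v G u * (Real.exp (r / (2 * v)) * (2 - Real.exp (K * r))) ≤
      radialProfile n v G (u - r) := by
  have hsu : 0 < √u := Real.sqrt_pos.2 hu
  have hexp : 2 - Real.exp (K * r) ≤ 1 - K * r := by linarith [Real.add_one_le_exp (K * r)]
  have hF := radialProfile_nonneg (n := n) (v := v) hG
  have hn' : (1 : ℝ) ≤ n := by exact_mod_cast hn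
  have hK1 : 1 / u ≤ K := by
    have h1 : 1 / u ≤ n / u := by gcongr
    have h2 : 0 ≤ s / √u := by positivity
    linarith
  rcases le_or_gt 1 (K * r) with h1 | h1
  -- When `K r ≥ 1` the left side is nonpositive; otherwise `1 / u ≤ K` forces `r < u`.
  · refine le_trans (mul_nonpos_of_nonneg_of_nonpos (hF u) ?_) (hF _)
    exact mul_nonpos_of_nonneg_of_nonpos (Real.exp_nonneg _) (by linarith)
  have hru : r / u < 1 := by
    refine lt_of_le_of_lt ?_ h1
    rw [div_eq_mul_one_div, mul_comm]
    gcongr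
  have hur : 0 < u - r := by rw [div_lt_one hu] at hru; linarith
  have hx : √u * (1 - r / u) ≤ √(u - r) := by
    have h2 : √u * (1 - r / u) = (u - r) / √u := by
      rw [one_sub_div hu.ne', ← Real.sq_sqrt hu.le]
      rw [Real.sqrt_sq hsu.le]
      field_simp
    rw [h2, div_le_iff₀ hsu]
    calc u - r = √(u - r) * √(u - r) := (Real.mul_self_sqrt hur.le).symm
      _ ≤ √(u - r) * √u := by gcongr; linarith
  -- Bernoulli's inequality applied to `(1 - r / u) ^ n`.
  have hpow : √u ^ n * (1 - n * (r / u)) ≤ √(u - r) ^ n := by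
    have hb := one_add_mul_le_pow (a := -(r / u)) (by linarith) n
    calc √u ^ n * (1 - n * (r / u)) = √u ^ n * (1 + n * -(r / u)) := by ring
      _ ≤ √u ^ n * (1 + -(r / u)) ^ n := by gcongr
      _ = (√u * (1 - r / u)) ^ n := by rw [mul_pow]; ring
      _ ≤ _ := by
        have : 0 ≤ √u * (1 - r / u) := mul_nonneg hsu.le (by linarith)
        gcongr
  have hGu := hG _ hsu.le
  have hGr : G √u * (1 - s * r / √u) ≤ G √(u - r) := by
    have h := hanti (Set.mem_Ici.2 (Real.sqrt_nonneg (u - r))) (Set.mem_Ici.2 hsu.le)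
      (Real.sqrt_le_sqrt (by linarith : u - r ≤ u))
    have h3 : √u - √(u - r) ≤ r / √u := by
      have : √u * (1 - r / u) = √u - r / √u := by
        rw [mul_sub, mul_one, sub_right_inj]
        nth_rewrite 2 [← Real.mul_self_sqrt hu.le]
        field_simp
      linarith
    have h4 : 1 - s * r / √u ≤ Real.exp (-(s * (√u - √(u - r)))) := by
      have := Real.add_one_le_exp (-(s * (√u - √(u - r))))
      have h5 : s * (√u - √(u - r)) ≤ s * (r / √u) := by gcongr
      rw [mul_div_assoc]
      linarith
    calc G √u * (1 - s * r / √u) ≤ G √u * Real.exp (-(s * (√u - √(u - r)))) := by gcongr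
      _ = Real.exp (s * √(u - r)) * (Real.exp (-(s * √u)) * G √u) := by
        rw [mul_comm, ← mul_assoc, ← Real.exp_add]
        ring_nf
      _ ≤ Real.exp (s * √(u - r)) * (Real.exp (-(s * √(u - r))) * G √(u - r)) := by gcongr
      _ = _ := by rw [← mul_assoc, ← Real.exp_add, add_neg_cancel, Real.exp_zero, one_mul]
  have hKr : (n : ℝ) * (r / u) + s * r / √u ≤ K * r := by
    calc (n : ℝ) * (r / u) + s * r / √u = (n / u + s / √u) * r := by ring
      _ ≤ _ := by gcongr
  have ha : 0 ≤ (n : ℝ) * (r / u) := by positivity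
  have hb : 0 ≤ s * r / √u := by positivity
  have e : Real.exp (-(u - r) / (2 * v)) = Real.exp (-u / (2 * v)) * Real.exp (r / (2 * v)) := by
    rw [← Real.exp_add]; congr 1; ring
  have hGr0 : 0 ≤ G √u * (1 - s * r / √u) := mul_nonneg hGu (by linarith)
  calc radialProfile n v G u * (Real.exp (r / (2 * v)) * (2 - Real.exp (K * r)))
      = Real.exp (-u / (2 * v)) * Real.exp (r / (2 * v)) *
          (√u ^ n * G √u * (2 - Real.exp (K * r))) := by rw [radialProfile]; ring
    _ ≤ Real.exp (-u / (2 * v)) * Real.exp (r / (2 * v)) *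
          (√u ^ n * G √u * ((1 - n * (r / u)) * (1 - s * r / √u))) := by
        gcongr
        -- `(1 - α) (1 - β) ≥ 1 - α - β ≥ 1 - K r ≥ 2 - exp (K r)`.
        nlinarith [mul_nonneg ha hb]
    _ = Real.exp (-u / (2 * v)) * Real.exp (r / (2 * v)) *
          ((√u ^ n * (1 - n * (r / u))) * (G √u * (1 - s * r / √u))) := by ring
    _ ≤ Real.exp (-u / (2 * v)) * Real.exp (r / (2 * v)) * (√(u - r) ^ n * G √(u - r)) := by
        gcongr
    _ = _ := by rw [radialProfile, e]; ring

end RadialProfile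

/-! ### The spherical integral of `cosh` and its growth. -/

section SphereCosh

open Metric Module

variable {E : Type*} [NormedAddCommGroup E] [InnerProductSpace ℝ E] [FiniteDimensional ℝ E]
  [MeasurableSpace E] [BorelSpace E]

/-- The integral of `cosh (x ⟪b, θ⟫)` over the unit sphere. -/
def sphereCosh (b : E) (x : ℝ) : ℝ :=
  ∫ θ, Real.cosh (x * inner ℝ b (θ : E)) ∂(volume : Measure E).toSphere

lemma continuous_sphereCosh (b : E) : Continuous (sphereCosh b) := by
  have : CompactSpace (sphere (0 : E) 1) := isCompact_iff_compactSpace.1 (isCompact_sphere 0 1)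
  have h := continuous_parametric_integral_of_continuous (μ := (volume : Measure E).toSphere)
    (f := fun (x : ℝ) (θ : sphere (0 : E) 1) => Real.cosh (x * inner ℝ b (θ : E)))
    (s := Set.univ) (by fun_prop) isCompact_univ
  simp only [Measure.restrict_univ] at h
  exact h

lemma integrable_cosh_sphere (b : E) (x : ℝ) :
    Integrable (fun θ : sphere (0 : E) 1 => Real.cosh (x * inner ℝ b (θ : E)))
      (volume : Measure E).toSphere := by
  have : CompactSpace (sphere (0 : E) 1) := isCompact_iff_compactSpace.1 (isCompact_sphere 0 1)
  exact (show Continuous fun θ : sphere (0 : E) 1 => Real.cosh (x * inner ℝ b (θ : E)) by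
    fun_prop).integrable_of_hasCompactSupport (HasCompactSupport.of_compactSpace _)

lemma sphereCosh_nonneg (b : E) (x : ℝ) : 0 ≤ sphereCosh b x :=
  integral_nonneg fun _ => (Real.cosh_pos _).le

lemma monotoneOn_sphereCosh (b : E) : MonotoneOn (sphereCosh b) (Set.Ici 0) := by
  intro x hx y hy hxy
  refine integral_mono (integrable_cosh_sphere b x) (integrable_cosh_sphere b y) fun θ => ?_
  rw [Real.cosh_le_cosh, abs_mul, abs_mul, abs_of_nonneg (Set.mem_Ici.1 hx),
    abs_of_nonneg (Set.mem_Ici.1 hy)]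
  gcongr

/-- For `|y| ≤ ‖b‖`, `exp (-‖b‖ x) cosh (x y)` is the mean of `exp (-(‖b‖ - y) x)` and `exp (-(‖b‖ +
y) x)`, both decreasing in `x`. -/
lemma antitoneOn_exp_mul_sphereCosh (b : E) :
    AntitoneOn (fun x => Real.exp (-(‖b‖ * x)) * sphereCosh b x) (Set.Ici 0) := by
  intro x _ y _ hxy
  simp only [sphereCosh]
  rw [← integral_const_mul, ← integral_const_mul]
  refine integral_mono ((integrable_cosh_sphere b y).const_mul _)
    ((integrable_cosh_sphere b x).const_mul _) fun θ => ?_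
  have h : |inner ℝ b (θ : E)| ≤ ‖b‖ := by
    simpa using abs_real_inner_le_norm b (θ : E)
  obtain ⟨h1, h2⟩ := abs_le.1 h
  have e : ∀ z : ℝ, Real.exp (-(‖b‖ * z)) * Real.cosh (z * inner ℝ b (θ : E)) =
      (Real.exp (-((‖b‖ - inner ℝ b (θ : E)) * z)) +
        Real.exp (-((‖b‖ + inner ℝ b (θ : E)) * z))) / 2 := by
    intro z
    rw [Real.cosh_eq, mul_div_assoc', mul_add, ← Real.exp_add, ← Real.exp_add]
    ring_nf
  dsimp only
  rw [e, e]
  have h3 : 0 ≤ ‖b‖ - inner ℝ b (θ : E) := by linarith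
  have h4 : 0 ≤ ‖b‖ + inner ℝ b (θ : E) := by linarith
  gcongr

end SphereCosh

/-! ### The explicit density of a noncentral Gaussian squared norm. -/

section GaussianNormSq

variable {T : Type*} [Fintype T] {Ω : Type*} [MeasurableSpace Ω] {P : Measure Ω}

/-- The density of the squared norm of a Gaussian vector with mean `b` and covariance `v • 1`. -/
def gaussianNormSqDensity (b : EuclideanSpace ℝ T) (v : ℝ) (u : ℝ) : ℝ :=
  1 / 2 * (√(2 * Real.pi * v))⁻¹ ^ Fintype.card T * Real.exp (-‖b‖ ^ 2 / (2 * v)) *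
    radialProfile (Fintype.card T - 2) v (sphereCosh (v⁻¹ • b)) u

lemma symmetrized_exp (b x : EuclideanSpace ℝ T) (c v : ℝ) :
    1 / 2 * (c * Real.exp (-‖x - b‖ ^ 2 / (2 * v)) + c * Real.exp (-‖-x - b‖ ^ 2 / (2 * v))) =
      c * Real.exp (-‖b‖ ^ 2 / (2 * v)) * Real.exp (-‖x‖ ^ 2 / (2 * v)) *
        Real.cosh (inner ℝ (v⁻¹ • b) x) := by
  have h1 : ‖x - b‖ ^ 2 = ‖x‖ ^ 2 - 2 * inner ℝ b x + ‖b‖ ^ 2 := by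
    rw [norm_sub_sq_real, real_inner_comm]
  have h2 : ‖-x - b‖ ^ 2 = ‖x‖ ^ 2 + 2 * inner ℝ b x + ‖b‖ ^ 2 := by
    rw [norm_sub_sq_real, norm_neg, inner_neg_left, real_inner_comm]; ring
  have e1 : -(‖x‖ ^ 2 - 2 * inner ℝ b x + ‖b‖ ^ 2) / (2 * v) =
      -‖b‖ ^ 2 / (2 * v) + -‖x‖ ^ 2 / (2 * v) + v⁻¹ * inner ℝ b x := by
    rcases eq_or_ne v 0 with rfl | hv
    · simp
    · field_simp
      ring
  have e2 : -(‖x‖ ^ 2 + 2 * inner ℝ b x + ‖b‖ ^ 2) / (2 * v) =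
      -‖b‖ ^ 2 / (2 * v) + -‖x‖ ^ 2 / (2 * v) + -(v⁻¹ * inner ℝ b x) := by
    rcases eq_or_ne v 0 with rfl | hv
    · simp
    · field_simp
      ring
  rw [Real.cosh_eq, real_inner_smul_left, h1, h2, e1, e2, Real.exp_add (_ + _) (v⁻¹ * _), Real.exp_add,
    Real.exp_add (_ + _) (-_), Real.exp_add]
  ring

lemma isContinuousDensity_gaussianNormSq (hT : 3 ≤ Fintype.card T) {Z : T → Ω → ℝ}
    {b : EuclideanSpace ℝ T} {v : ℝ≥0} (hv : v ≠ 0) (hZ : iIndepFun Z P)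
    (hlaw : ∀ i, HasLaw (Z i) (gaussianReal (b i) v) P) :
    IsContinuousDensity P (fun ω => ∑ i, Z i ω ^ 2) (gaussianNormSqDensity b v) := by
  have hm : AEMeasurable (fun ω => WithLp.toLp 2 (fun i => Z i ω)) P := by
    have := fun i => (hlaw i).aemeasurable
    fun_prop
  have hnn := radialProfile_nonneg (n := Fintype.card T - 2) (v := v)
    (fun x _ => sphereCosh_nonneg ((v : ℝ)⁻¹ • b) x)
  refine ⟨?_, ?_, ?_, ?_⟩
  · have := fun i => (hlaw i).aemeasurable
    fun_prop
  · exact continuous_const.mul (continuous_radialProfile (continuous_sphereCosh _))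
  · intro u
    have := hnn u
    unfold gaussianNormSqDensity
    positivity
  · have : Nonempty T := Fintype.card_pos_iff.1 (by omega)
    have e : (fun ω => ∑ i, Z i ω ^ 2) =
        (fun x : EuclideanSpace ℝ T => ‖x‖ ^ 2) ∘ fun ω => WithLp.toLp 2 (fun i => Z i ω) := by
      ext ω
      simp [EuclideanSpace.real_norm_sq_eq]
    rw [e, ← AEMeasurable.map_map_of_aemeasurable (by fun_prop) hm,
      map_toLp_eq_withDensity hv hZ hlaw, withDensity_map_norm_sq_symmetrize _ (by fun_prop),
      map_norm_sq_withDensity _ (by simpa using hT) (by fun_prop)]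
    congr 1
    ext u
    set c := (√(2 * Real.pi * v))⁻¹ ^ Fintype.card T with hc
    have hc0 : 0 ≤ c := by positivity
    have hhalf : (2⁻¹ : ℝ≥0∞) = ENNReal.ofReal (1 / 2) := by
      rw [ENNReal.ofReal_div_of_pos (by norm_num)]; simp
    have e1 : ∀ x : EuclideanSpace ℝ T,
        2⁻¹ * (ENNReal.ofReal (c * Real.exp (-‖x - b‖ ^ 2 / (2 * v))) +
          ENNReal.ofReal (c * Real.exp (-‖-x - b‖ ^ 2 / (2 * v)))) =
        ENNReal.ofReal (c * Real.exp (-‖b‖ ^ 2 / (2 * v)) * Real.exp (-‖x‖ ^ 2 / (2 * v)) *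
          Real.cosh (inner ℝ ((v : ℝ)⁻¹ • b) x)) := by
      intro x
      rw [← ENNReal.ofReal_add (by positivity) (by positivity), hhalf,
        ← ENNReal.ofReal_mul (by norm_num), symmetrized_exp]
    simp_rw [e1]
    rcases le_or_gt u 0 with hu | hu
    · rw [gaussianNormSqDensity, radialProfile_of_nonpos (by omega) hu]
      simp [Real.sqrt_eq_zero_of_nonpos hu, show Fintype.card T - 2 ≠ 0 by omega]
    · have e2 : ∀ θ : Metric.sphere (0 : EuclideanSpace ℝ T) 1,
          c * Real.exp (-‖b‖ ^ 2 / (2 * v)) *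
            Real.exp (-‖√u • (θ : EuclideanSpace ℝ T)‖ ^ 2 / (2 * v)) *
            Real.cosh (inner ℝ ((v : ℝ)⁻¹ • b) (√u • (θ : EuclideanSpace ℝ T))) =
          c * Real.exp (-‖b‖ ^ 2 / (2 * v)) * Real.exp (-u / (2 * v)) *
            Real.cosh (√u * inner ℝ ((v : ℝ)⁻¹ • b) (θ : EuclideanSpace ℝ T)) := by
        intro θ
        rw [norm_smul, norm_eq_of_mem_sphere θ, mul_one, Real.norm_eq_abs, sq_abs,
          Real.sq_sqrt hu.le, inner_smul_right]
      simp_rw [e2]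
      rw [← ofReal_integral_eq_lintegral_ofReal ((integrable_cosh_sphere _ _).const_mul _)
        (ae_of_all _ fun θ => mul_nonneg (by positivity) (Real.cosh_pos _).le),
        ← ENNReal.ofReal_mul (by positivity), integral_const_mul]
      congr 1
      rw [gaussianNormSqDensity, radialProfile, sphereCosh, finrank_euclideanSpace]
      ring

end GaussianNormSq

/-! ### Uniqueness of continuous densities, and convolution with a nonnegative variable. -/

section Sum

variable {Ω : Type*} [MeasurableSpace Ω] {P : Measure Ω}

lemma IsContinuousDensity.eq {X : Ω → ℝ} {p q : ℝ → ℝ} (hp : IsContinuousDensity P X p)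
    (hq : IsContinuousDensity P X q) : p = q := by
  have h := (withDensity_eq_iff_of_sigmaFinite
    (by have := hp.continuous; fun_prop) (by have := hq.continuous; fun_prop)).1
    (hp.map_eq.symm.trans hq.map_eq)
  refine (hp.continuous.ae_eq_iff_eq volume hq.continuous).1 ?_
  filter_upwards [h] with u hu
  exact (ENNReal.ofReal_eq_ofReal_iff (hp.nonneg u) (hq.nonneg u)).1 hu

lemma IsContinuousDensity.exists_bound_of_le {X : Ω → ℝ} {f : ℝ → ℝ}
    (hf : IsContinuousDensity P X f) (hf0 : ∀ u ≤ 0, f u = 0) (U : ℝ) :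
    ∃ C, ∀ u ≤ U, ‖f u‖ ≤ C := by
  obtain ⟨C, hC⟩ := (isCompact_Icc (a := 0) (b := U)).exists_bound_of_continuousOn
    hf.continuous.continuousOn
  refine ⟨max C 0, fun u hu => ?_⟩
  rcases le_or_gt u 0 with h | h
  · simp [hf0 u h]
  · exact (hC u ⟨h.le, hu⟩).trans (le_max_left _ _)

lemma IsContinuousDensity.integrable_comp_sub [IsFiniteMeasure P] {X R : Ω → ℝ} {f : ℝ → ℝ}
    (hf : IsContinuousDensity P X f) (hf0 : ∀ u ≤ 0, f u = 0) (hR : AEMeasurable R P)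
    (hR0 : ∀ ω, 0 ≤ R ω) (u : ℝ) : Integrable (fun ω => f (u - R ω)) P := by
  obtain ⟨C, hC⟩ := hf.exists_bound_of_le hf0 u
  refine Integrable.of_bound ?_ C (ae_of_all _ fun ω => hC _ (by linarith [hR0 ω]))
  exact (hf.continuous.measurable.comp_aemeasurable (by fun_prop)).aestronglyMeasurable

/-- The density of the sum of two independent variables, if one of them has a continuous density
that vanishes on the negative axis and the other one is nonnegative. -/
lemma IsContinuousDensity.add_of_indepFun [IsFiniteMeasure P] {X R : Ω → ℝ} {f : ℝ → ℝ}
    (hf : IsContinuousDensity P X f) (hf0 : ∀ u ≤ 0, f u = 0) (hR : AEMeasurable R P)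
    (hR0 : ∀ ω, 0 ≤ R ω) (hXR : IndepFun X R P) :
    IsContinuousDensity P (fun ω => X ω + R ω) (fun u => ∫ ω, f (u - R ω) ∂P) := by
  have hfm := hf.continuous.measurable
  refine ⟨hf.aemeasurable.add hR, ?_, fun u => integral_nonneg fun ω => hf.nonneg _, ?_⟩
  · refine continuous_iff_continuousAt.2 fun u => ?_
    -- As `R ≥ 0`, only values of `f` on `(-∞, u + 1]` occur near `u`, and there `f` is bounded;
    -- dominated convergence applies.
    obtain ⟨C, hC⟩ := hf.exists_bound_of_le hf0 (u + 1)
    refine continuousAt_of_dominated (bound := fun _ => C) ?_ ?_ (integrable_const _) ?_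
    · exact Eventually.of_forall fun x =>
        (hfm.comp_aemeasurable (by fun_prop)).aestronglyMeasurable
    · filter_upwards [Iio_mem_nhds (by linarith : u < u + 1)] with x hx
      exact ae_of_all _ fun ω => hC _ (by linarith [hR0 ω, Set.mem_Iio.1 hx])
    · exact ae_of_all _ fun ω => (hf.continuous.comp (by fun_prop)).continuousAt
  · have h1 : P.map (fun ω => X ω + R ω) =
        ((P.map X).prod (P.map R)).map (fun p => p.1 + p.2) := by
      rw [← (indepFun_iff_map_prod_eq_prod_map_map hf.aemeasurable hR).1 hXR,
        AEMeasurable.map_map_of_aemeasurable (by fun_prop) (hf.aemeasurable.prodMk hR)]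
      rfl
    ext s hs
    have hsm : Measurable (s.indicator (1 : ℝ → ℝ≥0∞)) := measurable_one.indicator hs
    have e : ∀ u, ENNReal.ofReal (∫ ω, f (u - R ω) ∂P) =
        ∫⁻ r, ENNReal.ofReal (f (u - r)) ∂(P.map R) := by
      intro u
      rw [ofReal_integral_eq_lintegral_ofReal (hf.integrable_comp_sub hf0 hR hR0 u)
        (ae_of_all _ fun ω => hf.nonneg _), lintegral_map' (by fun_prop) hR]
    rw [h1, ← lintegral_indicator_one hs, lintegral_map hsm (by fun_prop),
      lintegral_prod_symm _ (by fun_prop), withDensity_apply _ hs,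
      ← lintegral_indicator hs]
    simp_rw [e]
    have e2 : ∀ u, s.indicator (fun u => ∫⁻ r, ENNReal.ofReal (f (u - r)) ∂(P.map R)) u =
        ∫⁻ r, ENNReal.ofReal (f (u - r)) * s.indicator 1 u ∂(P.map R) := by
      intro u
      rw [lintegral_mul_const _ (by fun_prop)]
      by_cases hu : u ∈ s <;> simp [hu]
    rw [lintegral_congr e2]
    refine Eq.trans ?_ (lintegral_lintegral_swap (by fun_prop)).symm
    refine lintegral_congr fun r => ?_
    rw [hf.map_eq, lintegral_withDensity_eq_lintegral_mul _ (by fun_prop) (by fun_prop),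
      ← lintegral_add_right_eq_self (fun x => ENNReal.ofReal (f (x - r)) * s.indicator 1 x) r]
    simp

end Sum

/-! ### Splitting the squared norm along the eigenbasis. -/

section Basis

variable {H : Type*} [NormedAddCommGroup H] [InnerProductSpace ℝ H] {ι : Type*}

/-- Orthonormal vectors lie `√2` apart, so balls of radius `1/2` around them are disjoint open sets
in a separable space. -/
lemma Orthonormal.countable_index [SecondCountableTopology H] {e : ι → H}
    (he : Orthonormal ℝ e) : Countable ι := by
  have hd : (Set.univ : Set ι).PairwiseDisjoint fun i => Metric.ball (e i) (1 / 2) := by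
    intro i _ j _ hij
    refine Metric.ball_disjoint_ball ?_
    have h2 : ‖e i - e j‖ ^ 2 = 2 := by
      rw [norm_sub_sq_real, he.1 i, he.1 j, he.2 hij]; norm_num
    rw [dist_eq_norm]
    nlinarith [norm_nonneg (e i - e j)]
  exact Set.countable_univ_iff.1 (hd.countable_of_isOpen (fun _ _ => Metric.isOpen_ball)
    fun i _ => ⟨e i, Metric.mem_ball_self (by norm_num)⟩)

variable (e : HilbertBasis ι ℝ H) (σ : ι → ℝ) (σ₁ : ℝ)

lemma HilbertBasis.hasSum_sq_inner (x : H) :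
    HasSum (fun i => (inner ℝ (e i) x) ^ 2) (‖x‖ ^ 2) := by
  have h := e.hasSum_inner_mul_inner x x
  rw [real_inner_self_eq_norm_sq] at h
  refine h.congr_fun fun i => ?_
  rw [real_inner_comm, sq]

lemma hasSum_restSq (x : H) :
    HasSum (fun j : {j // σ j ≠ σ₁} => (inner ℝ (e j) x) ^ 2) (restSq e σ σ₁ x) :=
  ((e.hasSum_sq_inner x).summable.subtype {j | σ j ≠ σ₁}).hasSum

lemma restSq_nonneg (x : H) : 0 ≤ restSq e σ σ₁ x := tsum_nonneg fun _ => sq_nonneg _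

lemma topSq_nonneg (x : H) : 0 ≤ topSq e σ σ₁ x := tsum_nonneg fun _ => sq_nonneg _

lemma topSq_add_restSq (x : H) : topSq e σ σ₁ x + restSq e σ σ₁ x = ‖x‖ ^ 2 := by
  have h := e.hasSum_sq_inner x
  rw [← h.tsum_eq]
  exact h.summable.tsum_subtype_add_tsum_subtype_compl {i | σ i = σ₁}

lemma restSq_le (x : H) : restSq e σ σ₁ x ≤ ‖x‖ ^ 2 := by
  linarith [topSq_add_restSq e σ σ₁ x, topSq_nonneg e σ σ₁ x]

end Basis

/-! ### Laws, independence and second moments of the coordinates. -/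

section Coordinates

variable {Ω : Type*} [MeasurableSpace Ω] {P : Measure Ω}
  {H : Type*} [NormedAddCommGroup H] [InnerProductSpace ℝ H] [CompleteSpace H]
  [SecondCountableTopology H] [MeasurableSpace H] [BorelSpace H]
  {Y : Ω → H} {ι : Type*} {e : HilbertBasis ι ℝ H} {σ : ι → ℝ}

omit [CompleteSpace H] [SecondCountableTopology H] in
lemma isGaussianProcess_inner (hY : HasGaussianLaw Y P) (e : ι → H) :
    IsGaussianProcess (fun i ω => inner ℝ (e i) (Y ω)) P where
  hasGaussianLaw I := hY.map (ContinuousLinearMap.pi fun i : I => innerSL ℝ (e i))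

lemma integral_inner_eq_zero (hY : HasGaussianLaw Y P) (hY0 : ∫ ω, Y ω ∂P = 0) (x : H) :
    ∫ ω, inner ℝ x (Y ω) ∂P = 0 := by
  rw [integral_inner hY.integrable, hY0, inner_zero_right]

lemma integral_inner_mul_inner (hY : HasGaussianLaw Y P) (he : IsCovarianceEigenbasis P Y e σ)
    (i j : ι) [Decidable (i = j)] :
    ∫ ω, inner ℝ (e i) (Y ω) * inner ℝ (e j) (Y ω) ∂P = if i = j then σ i ^ 2 else 0 := by
  have h2 : MemLp id 2 (P.map Y) := by
    rw [memLp_map_measure_iff aestronglyMeasurable_id hY.aemeasurable]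
    exact hY.memLp_two
  have h := covarianceOperator_inner h2 (e i) (e j)
  rw [he.eigen i, real_inner_smul_left, integral_map hY.aemeasurable (by fun_prop)] at h
  rw [← h]
  split_ifs with hij
  · rw [hij, real_inner_self_eq_norm_sq, e.orthonormal.1 j]; simp
  · rw [e.orthonormal.2 hij, mul_zero]

lemma covariance_inner (hY : HasGaussianLaw Y P) (hY0 : ∫ ω, Y ω ∂P = 0)
    (he : IsCovarianceEigenbasis P Y e σ) (i j : ι) [Decidable (i = j)] :
    cov[fun ω => inner ℝ (e i) (Y ω), fun ω => inner ℝ (e j) (Y ω); P] =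
      if i = j then σ i ^ 2 else 0 := by
  have := hY.isProbabilityMeasure
  rw [covariance_eq_sub (hY.memLp_two.const_inner _) (hY.memLp_two.const_inner _),
    integral_inner_eq_zero hY hY0, zero_mul, sub_zero, ← integral_inner_mul_inner hY he i j]
  rfl

lemma hasLaw_inner_sub (hY : HasGaussianLaw Y P) (hY0 : ∫ ω, Y ω ∂P = 0)
    (he : IsCovarianceEigenbasis P Y e σ) (a : H) (i : ι) :
    HasLaw (fun ω => inner ℝ (e i) (Y ω - a))
      (gaussianReal (-inner ℝ (e i) a) (σ i ^ 2).toNNReal) P := by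
  classical
  have hg : HasGaussianLaw (fun ω => inner ℝ (e i) (Y ω)) P := hY.map_fun (innerSL ℝ (e i))
  have h : HasLaw (fun ω => inner ℝ (e i) (Y ω)) (gaussianReal 0 (σ i ^ 2).toNNReal) P := by
    refine ⟨hg.aemeasurable, ?_⟩
    rw [hg.map_eq_gaussianReal, integral_inner_eq_zero hY hY0,
      ← covariance_self hg.aemeasurable, covariance_inner hY hY0 he, if_pos rfl]
  simpa [inner_sub_right] using gaussianReal_sub_const h (inner ℝ (e i) a)

lemma iIndepFun_inner_sub (hY : HasGaussianLaw Y P) (hY0 : ∫ ω, Y ω ∂P = 0)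
    (he : IsCovarianceEigenbasis P Y e σ) (a : H) :
    iIndepFun (fun i ω => inner ℝ (e i) (Y ω - a)) P := by
  classical
  have hp : IsGaussianProcess
      (fun (p : (_ : ι) × Unit) ω => inner ℝ (e p.1) (Y ω)) P := isGaussianProcess_inner hY _
  have h := IsGaussianProcess.iIndepFun_of_covariance_eq_zero
    (X := fun (i : ι) (_ : Unit) ω => inner ℝ (e i) (Y ω)) hp
    (fun i _ => hp.aemeasurable ⟨i, ()⟩)
    (fun i j hij _ _ => by rw [covariance_inner hY hY0 he, if_neg hij])
  simpa [inner_sub_right, Function.comp_def] using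
    h.comp (fun i f => f () - inner ℝ (e i) a) (fun i => by fun_prop)

omit [CompleteSpace H] in
lemma aemeasurable_remainder [Countable ι] (hY : AEMeasurable Y P) (σ₁ : ℝ) (a : H) :
    AEMeasurable (remainder Y e σ σ₁ a) P :=
  AEMeasurable.tsum fun j => by fun_prop

/-- The two blocks of coordinates are jointly Gaussian and uncorrelated, hence independent. -/
lemma indepFun_topSq_remainder [Countable ι] (hY : HasGaussianLaw Y P) (hY0 : ∫ ω, Y ω ∂P = 0)
    (he : IsCovarianceEigenbasis P Y e σ) (σ₁ : ℝ) [Fintype {i // σ i = σ₁}] (a : H) :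
    IndepFun (fun ω => topSq e σ σ₁ (Y ω - a)) (remainder Y e σ σ₁ a) P := by
  classical
  have hm : ∀ i, AEMeasurable (fun ω => inner ℝ (e i) (Y ω)) P := fun i =>
    (isGaussianProcess_inner hY e).aemeasurable i
  have hp : IsGaussianProcess (Sum.elim
      (fun (i : {i // σ i = σ₁}) ω => inner ℝ (e i) (Y ω))
      (fun (j : {j // σ j ≠ σ₁}) ω => inner ℝ (e j) (Y ω))) P := by
    convert isGaussianProcess_inner hY
      (Sum.elim (fun i : {i // σ i = σ₁} => e i) (fun j : {j // σ j ≠ σ₁} => e j)) using 2 with p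
    rcases p with p | p <;> rfl
  have h := hp.indepFun_of_covariance_eq_zero (fun _ => hm _) (fun _ => hm _) (fun i j => by
    rw [covariance_inner hY hY0 he, if_neg]
    intro hij
    exact j.2 (hij ▸ i.2))
  have h2 := h.comp (φ := fun x : {i // σ i = σ₁} → ℝ => ∑ i, (x i - inner ℝ (e i) a) ^ 2)
    (ψ := fun x : {j // σ j ≠ σ₁} → ℝ =>
      ∑' j, (x j - inner ℝ (e j) a) ^ 2) (by fun_prop) (Measurable.tsum fun j => by fun_prop)
  convert h2 using 1
  · ext ω
    simp [topSq, inner_sub_right, tsum_fintype]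
  · ext ω
    simp [remainder, restSq, inner_sub_right]

lemma integral_inner_sub_sq (hY : HasGaussianLaw Y P) (hY0 : ∫ ω, Y ω ∂P = 0)
    (he : IsCovarianceEigenbasis P Y e σ) (a : H) (i : ι) :
    ∫ ω, (inner ℝ (e i) (Y ω - a)) ^ 2 ∂P = σ i ^ 2 + (inner ℝ (e i) a) ^ 2 := by
  classical
  have := hY.isProbabilityMeasure
  have hL : MemLp (fun ω => inner ℝ (e i) (Y ω)) 2 P := hY.memLp_two.const_inner _
  have h1 : ∀ ω, (inner ℝ (e i) (Y ω - a)) ^ 2 =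
      inner ℝ (e i) (Y ω) * inner ℝ (e i) (Y ω) -
        (2 * inner ℝ (e i) a) * inner ℝ (e i) (Y ω) + (inner ℝ (e i) a) ^ 2 := by
    intro ω
    rw [inner_sub_right]; ring
  have hi : Integrable (fun ω => inner ℝ (e i) (Y ω) * inner ℝ (e i) (Y ω)) P := by
    simpa [sq] using hL.integrable_sq
  have hi2 : Integrable (fun ω => (2 * inner ℝ (e i) a) * inner ℝ (e i) (Y ω)) P :=
    (hL.integrable (by norm_num)).const_mul _
  simp_rw [h1]
  rw [integral_add (by exact hi.sub hi2) (integrable_const _), integral_sub hi hi2, integral_const_mul,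
    integral_inner_eq_zero hY hY0, integral_inner_mul_inner hY he, if_pos rfl]
  simp

lemma integrable_remainder [Countable ι] (hY : HasGaussianLaw Y P) (σ₁ : ℝ) (a : H) :
    Integrable (remainder Y e σ σ₁ a) P := by
  have := hY.isProbabilityMeasure
  have h : Integrable (fun ω => ‖Y ω - a‖ ^ 2) P :=
    (hY.memLp_two.sub (memLp_const a)).integrable_norm_pow (by norm_num)
  refine h.mono' (aemeasurable_remainder hY.aemeasurable σ₁ a).aestronglyMeasurable
    (ae_of_all _ fun ω => ?_)
  rw [remainder, Real.norm_of_nonneg (restSq_nonneg e σ σ₁ _)]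
  exact restSq_le e σ σ₁ _

/-- Bounding finite sums by the finite number `E R` is what yields summability of the eigenvalues
outside the top one, which is not assumed. -/
lemma sum_le_integral_remainder [Countable ι] (hY : HasGaussianLaw Y P)
    (hY0 : ∫ ω, Y ω ∂P = 0) (he : IsCovarianceEigenbasis P Y e σ) (σ₁ : ℝ) (a : H)
    (s : Finset {j // σ j ≠ σ₁}) :
    ∑ j ∈ s, (σ j ^ 2 + (inner ℝ (e j) a) ^ 2) ≤ ∫ ω, remainder Y e σ σ₁ a ω ∂P := by
  have := hY.isProbabilityMeasure
  simp_rw [← integral_inner_sub_sq hY hY0 he a]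
  have hint : ∀ i, Integrable (fun ω => (inner ℝ (e i) (Y ω - a)) ^ 2) P := fun i =>
    ((hY.memLp_two.sub (memLp_const a)).const_inner (e i)).integrable_sq
  rw [← integral_finsetSum s fun (j : {j // σ j ≠ σ₁}) _ => hint j]
  refine integral_mono (integrable_finsetSum _ fun j _ => hint j)
    (integrable_remainder hY σ₁ a) fun ω => ?_
  exact sum_le_hasSum s (fun _ _ => sq_nonneg _) (hasSum_restSq e σ σ₁ (Y ω - a))

end Coordinates

/-! ### The spectral gap below the top eigenvalue. -/

section NextSigma

variable {ι : Type*} {σ : ι → ℝ} {σ₁ : ℝ}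

lemma le_nextSigma {k : ℕ} (hσ₁ : IsTopEigenvalue σ σ₁ k) (j : {j // σ j ≠ σ₁}) :
    σ j ≤ nextSigma σ σ₁ :=
  le_ciSup (f := fun j : {j // σ j ≠ σ₁} => σ j) ⟨σ₁, by rintro _ ⟨i, rfl⟩; exact hσ₁.le i⟩ j

lemma nextSigma_nonneg (hσ : ∀ i, 0 ≤ σ i) : 0 ≤ nextSigma σ σ₁ := Real.iSup_nonneg fun j => hσ j

/-- By summability only finitely many `σ j` reach `σ₁ / 2`, and each of these is strictly below
`σ₁`; so the supremum is too. -/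
lemma nextSigma_lt {k : ℕ} (hσ : ∀ i, 0 ≤ σ i) (hσ₁ : IsTopEigenvalue σ σ₁ k)
    (hs : Summable fun j : {j // σ j ≠ σ₁} => σ j ^ 2) : nextSigma σ σ₁ < σ₁ := by
  have hpos := hσ₁.pos
  have hfin : {j : {j // σ j ≠ σ₁} | ¬ σ j ^ 2 < (σ₁ / 2) ^ 2}.Finite :=
    hs.tendsto_cofinite_zero.eventually (gt_mem_nhds (by positivity))
  have hM : ∃ M, 0 ≤ M ∧ M < σ₁ ∧ ∀ j ∈ hfin.toFinset, σ j ≤ M := by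
    rcases hfin.toFinset.eq_empty_or_nonempty with h | h
    · exact ⟨0, le_rfl, hpos, by rw [h]; simp⟩
    · obtain ⟨j, -, hj⟩ := Finset.exists_max_image hfin.toFinset (fun j => σ j) h
      exact ⟨σ j, hσ j, lt_of_le_of_ne (hσ₁.le j) j.2, hj⟩
  obtain ⟨M, hM0, hM1, hM⟩ := hM
  refine lt_of_le_of_lt (Real.iSup_le (a := max M (σ₁ / 2)) (fun j => ?_) (by positivity))
    (max_lt hM1 (by linarith))
  by_cases hj : σ j ^ 2 < (σ₁ / 2) ^ 2
  · exact (lt_of_pow_lt_pow_left₀ 2 (by positivity) hj).le.trans (le_max_right _ _)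
  · exact (hM j (by simpa using hj)).trans (le_max_left _ _)

end NextSigma

/-! ### Exponential moments of the remainder. -/

section Moments

lemma integrable_exp_and_integral_eq {Ω : Type*} [MeasurableSpace Ω] {P : Measure Ω} {R : Ω → ℝ}
    (hR : AEMeasurable R P) {t L : ℝ}
    (h : ∫⁻ ω, ENNReal.ofReal (Real.exp (t * R ω)) ∂P = ENNReal.ofReal (Real.exp L)) :
    Integrable (fun ω => Real.exp (t * R ω)) P ∧ ∫ ω, Real.exp (t * R ω) ∂P = Real.exp L := by
  have hm : AEStronglyMeasurable (fun ω => Real.exp (t * R ω)) P :=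
    (by fun_prop : AEMeasurable (fun ω => Real.exp (t * R ω)) P).aestronglyMeasurable
  have h0 : 0 ≤ᵐ[P] fun ω => Real.exp (t * R ω) := ae_of_all _ fun ω => Real.exp_nonneg _
  refine ⟨⟨hm, ?_⟩, ?_⟩
  · rw [hasFiniteIntegral_iff_ofReal h0, h]
    exact ENNReal.ofReal_lt_top
  · rw [integral_eq_lintegral_of_nonneg_ae h0 hm, h, ENNReal.toReal_ofReal (Real.exp_nonneg _)]

variable {Ω : Type*} [MeasurableSpace Ω] {P : Measure Ω}
  {H : Type*} [NormedAddCommGroup H] [InnerProductSpace ℝ H] [CompleteSpace H]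
  [SecondCountableTopology H] [MeasurableSpace H] [BorelSpace H]
  {Y : Ω → H} {ι : Type*} {e : HilbertBasis ι ℝ H} {σ : ι → ℝ} {σ₁ : ℝ}

lemma exp_moment_remainder [Countable ι] (hY : HasGaussianLaw Y P)
    (hY0 : ∫ ω, Y ω ∂P = 0) (he : IsCovarianceEigenbasis P Y e σ) (a : H) {t q : ℝ} (ht : 0 ≤ t)
    (hq : q < 1) (h : ∀ j : {j // σ j ≠ σ₁}, 2 * t * σ j ^ 2 ≤ q) :
    ∃ L, HasSum (fun j : {j // σ j ≠ σ₁} => logMgfSq t (-inner ℝ (e j) a) (σ j ^ 2)) L ∧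
      Integrable (fun ω => Real.exp (t * remainder Y e σ σ₁ a ω)) P ∧
      ∫ ω, Real.exp (t * remainder Y e σ σ₁ a ω) ∂P = Real.exp L := by
  have hs : Summable fun j : {j // σ j ≠ σ₁} => σ j ^ 2 + (inner ℝ (e j) a) ^ 2 :=
    summable_of_sum_le (fun _ => by positivity) (sum_le_integral_remainder hY hY0 he σ₁ a)
  have hs1 : Summable fun j : {j // σ j ≠ σ₁} => σ j ^ 2 :=
    hs.of_nonneg_of_le (fun _ => sq_nonneg _) fun j => by linarith [sq_nonneg (inner ℝ (e j) a)]
  have hL := (summable_logMgfSq (m := fun j : {j // σ j ≠ σ₁} => -inner ℝ (e j) a) ht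
    (fun j => sq_nonneg (σ j)) hq h hs1 (by
      simpa using (hasSum_restSq e σ σ₁ a).summable)).hasSum
  have hco : ∀ i, (((σ i ^ 2).toNNReal : ℝ≥0) : ℝ) = σ i ^ 2 := fun i =>
    Real.coe_toNNReal _ (sq_nonneg _)
  refine ⟨_, hL, integrable_exp_and_integral_eq (aemeasurable_remainder hY.aemeasurable σ₁ a) ?_⟩
  refine lintegral_exp_sum_sq
    ((iIndepFun_inner_sub hY hY0 he a).precomp (g := fun j : {j // σ j ≠ σ₁} => (j : ι))
      Subtype.val_injective)
    (fun j => hasLaw_inner_sub hY hY0 he a j) ht (fun j => ?_)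
    (fun ω => hasSum_restSq e σ σ₁ (Y ω - a)) ?_
  · rw [hco]
    exact (h j).trans_lt hq
  · simpa only [hco] using hL

end Moments

/-- Each of the two summands contributes at most `1/8`. -/
lemma threshold_bound {n s B u : ℝ} (hu : 0 < u) (h1 : 8 * n * B ≤ u)
    (h2 : 64 * s ^ 2 * B ^ 2 ≤ u) : (n / u + s / √u) * B ≤ 1 / 4 := by
  have hsu : 0 < √u := Real.sqrt_pos.2 hu
  have e1 : n / u * B ≤ 1 / 8 := by
    rw [div_mul_eq_mul_div, div_le_iff₀ hu]; linarith
  have e2 : s / √u * B ≤ 1 / 8 := by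
    rw [div_mul_eq_mul_div, div_le_iff₀ hsu]
    have : 8 * s * B ≤ √u := Real.le_sqrt_of_sq_le (by nlinarith)
    linarith
  linarith

lemma norm_toLp_inner_sq {H : Type*} [NormedAddCommGroup H] [InnerProductSpace ℝ H]
    {ι : Type*} {e : HilbertBasis ι ℝ H} {σ : ι → ℝ} {σ₁ : ℝ} [Fintype {i // σ i = σ₁}]
    (a : H) :
    ‖(WithLp.toLp 2 fun i : {i // σ i = σ₁} => -inner ℝ (e i) a :
      EuclideanSpace ℝ {i // σ i = σ₁})‖ ^ 2 = topSq e σ σ₁ a := by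
  simp [EuclideanSpace.real_norm_sq_eq, topSq, tsum_fintype]

/-! ### Moment growth, the product formula and the top density. -/

section Bounds

variable {Ω : Type*} [MeasurableSpace Ω] {P : Measure Ω}
  {H : Type*} [NormedAddCommGroup H] [InnerProductSpace ℝ H] [CompleteSpace H]
  [SecondCountableTopology H] [MeasurableSpace H] [BorelSpace H]
  {Y : Ω → H} {ι : Type*} {e : HilbertBasis ι ℝ H} {σ : ι → ℝ} {σ₁ : ℝ}

/-- Summing the termwise bound `logMgfSq_add_le`, the logarithm of the moment grows by at most `2δ
(1 - q)⁻² E R ≤ 1/2`. -/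
lemma exp_moment_remainder_add_le [Countable ι] (hY : HasGaussianLaw Y P)
    (hY0 : ∫ ω, Y ω ∂P = 0) (he : IsCovarianceEigenbasis P Y e σ) (a : H) {t δ q : ℝ} (ht : 0 ≤ t)
    (hδ : 0 ≤ δ) (hq0 : 0 ≤ q) (hq : q < 1) (h : ∀ j : {j // σ j ≠ σ₁}, 2 * t * σ j ^ 2 ≤ q)
    (hδR : δ * (((1 - q) ^ 2)⁻¹ * ∫ ω, remainder Y e σ σ₁ a ω ∂P) ≤ 1 / 4) :
    Integrable (fun ω => Real.exp ((t + δ) * remainder Y e σ σ₁ a ω)) P ∧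
      ∫ ω, Real.exp ((t + δ) * remainder Y e σ σ₁ a ω) ∂P ≤
        15 / 8 * ∫ ω, Real.exp (t * remainder Y e σ σ₁ a ω) ∂P := by
  set B := ∫ ω, remainder Y e σ σ₁ a ω ∂P with hB
  have hsum := sum_le_integral_remainder hY hY0 he σ₁ a
  have hs : Summable fun j : {j // σ j ≠ σ₁} => σ j ^ 2 + (inner ℝ (e j) a) ^ 2 :=
    summable_of_sum_le (fun _ => by positivity) hsum
  have hsB : ∑' j : {j // σ j ≠ σ₁}, (σ j ^ 2 + (inner ℝ (e j) a) ^ 2) ≤ B :=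
    hs.tsum_le_of_sum_le hsum
  have hq1 : 0 < 1 - q := by linarith
  have hδB : 4 * δ * B ≤ (1 - q) ^ 2 := by
    have : δ * (((1 - q) ^ 2)⁻¹ * B) = δ * B / (1 - q) ^ 2 := by rw [div_eq_mul_inv]; ring
    rw [this, div_le_iff₀ (by positivity)] at hδR
    linarith
  have hδσ : ∀ j : {j // σ j ≠ σ₁}, 4 * δ * σ j ^ 2 ≤ 1 - q := by
    intro j
    have h1 := hsum {j}
    rw [Finset.sum_singleton] at h1
    have h2 : σ j ^ 2 ≤ B := by linarith [sq_nonneg (inner ℝ (e j) a)]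
    have h3 : 4 * δ * σ j ^ 2 ≤ 4 * δ * B := by gcongr
    -- `4 δ B ≤ (1 - q)² ≤ 1 - q`, the last because `0 ≤ q < 1`.
    nlinarith
  obtain ⟨L, hL, -, hLe⟩ := exp_moment_remainder hY hY0 he a ht hq h
  -- At parameter `t + δ` half of the gap survives, so the moment is still finite.
  obtain ⟨L', hL', hi', hLe'⟩ := exp_moment_remainder (σ₁ := σ₁) hY hY0 he a (t := t + δ)
    (q := q + (1 - q) / 2) (by positivity) (by linarith) (fun j => by
      have h1 := h j
      have h2 := hδσ j
      linarith)
  refine ⟨hi', ?_⟩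
  have hLL : L' ≤ L + 2 * δ * ((1 - q) ^ 2)⁻¹ *
      ∑' j : {j // σ j ≠ σ₁}, (σ j ^ 2 + (inner ℝ (e j) a) ^ 2) := by
    refine hasSum_le (fun j => ?_) hL' (hL.add (hs.hasSum.mul_left (2 * δ * ((1 - q) ^ 2)⁻¹)))
    simpa using logMgfSq_add_le (m := -inner ℝ (e j) a) hδ ht (sq_nonneg (σ j)) hq (h j) (hδσ j)
  have hLL' : L' ≤ L + 1 / 2 := by
    have : 2 * δ * ((1 - q) ^ 2)⁻¹ *
        ∑' j : {j // σ j ≠ σ₁}, (σ j ^ 2 + (inner ℝ (e j) a) ^ 2) ≤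
        2 * δ * ((1 - q) ^ 2)⁻¹ * B := by gcongr
    linarith
  -- `e < 2.72 < (15/8)²`.
  have hhalf : Real.exp (1 / 2) ≤ 15 / 8 := by
    have h1 : Real.exp (1 / 2) ^ 2 = Real.exp 1 := by
      rw [← Real.exp_nat_mul]; norm_num
    nlinarith [Real.exp_pos (1 / 2), Real.exp_one_lt_d9]
  rw [hLe, hLe']
  calc Real.exp L' ≤ Real.exp (L + 1 / 2) := Real.exp_le_exp.2 hLL'
    _ = Real.exp (1 / 2) * Real.exp L := by rw [add_comm, Real.exp_add]
    _ ≤ 15 / 8 * Real.exp L := by gcongr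

lemma hasProd_expMoment [Countable ι] (hY : HasGaussianLaw Y P)
    (hY0 : ∫ ω, Y ω ∂P = 0) (he : IsCovarianceEigenbasis P Y e σ) {k : ℕ}
    (hσ₁ : IsTopEigenvalue σ σ₁ k) (a : H) {q : ℝ} (hq : q < 1)
    (h : ∀ j : {j // σ j ≠ σ₁}, σ j ^ 2 / σ₁ ^ 2 ≤ q) :
    Integrable (fun ω => Real.exp (remainder Y e σ σ₁ a ω / (2 * σ₁ ^ 2))) P ∧
    HasProd (fun j : {j // σ j ≠ σ₁} =>
      (1 - σ j ^ 2 / σ₁ ^ 2) ^ (-(1 / 2) : ℝ) *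
        Real.exp ((inner ℝ (e j) a) ^ 2 / (2 * (σ₁ ^ 2 - σ j ^ 2))))
      (expMoment P Y e σ σ₁ a) := by
  have hpos := hσ₁.pos
  have ht : ∀ x : ℝ, 2 * (1 / (2 * σ₁ ^ 2)) * x = x / σ₁ ^ 2 := fun x => by field_simp
  obtain ⟨L, hL, hi, hLe⟩ := exp_moment_remainder hY hY0 he a (t := 1 / (2 * σ₁ ^ 2))
    (by positivity) hq (fun j => by rw [ht]; exact h j)
  simp_rw [one_div_mul_eq_div] at hi hLe
  refine ⟨hi, ?_⟩
  rw [expMoment, hLe]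
  convert hL.rexp using 1
  ext j
  have hj : σ j ^ 2 / σ₁ ^ 2 < 1 := (h j).trans_lt hq
  rw [Function.comp_apply, exp_logMgfSq (by rw [ht]; exact hj), ht]
  congr 2
  have h1 : 0 < 1 - σ j ^ 2 / σ₁ ^ 2 := by linarith
  have h2 : 0 < σ₁ ^ 2 - σ j ^ 2 := by
    rw [div_lt_one (by positivity)] at hj; linarith
  have h3 : 1 - σ j ^ 2 / σ₁ ^ 2 = (σ₁ ^ 2 - σ j ^ 2) / σ₁ ^ 2 := by field_simp
  rw [h3]
  field_simp

lemma isContinuousDensity_topSq [Fintype {i // σ i = σ₁}]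
    (hY : HasGaussianLaw Y P) (hY0 : ∫ ω, Y ω ∂P = 0) (he : IsCovarianceEigenbasis P Y e σ)
    (hpos : 0 < σ₁) (hk : 3 ≤ Fintype.card {i // σ i = σ₁}) (a : H) :
    IsContinuousDensity P (fun ω => topSq e σ σ₁ (Y ω - a)) (gaussianNormSqDensity
      (WithLp.toLp 2 fun i : {i // σ i = σ₁} => -inner ℝ (e i) a) (σ₁ ^ 2)) := by
  have hv : ((σ₁ ^ 2).toNNReal : ℝ) = σ₁ ^ 2 := Real.coe_toNNReal _ (by positivity)
  have h := isContinuousDensity_gaussianNormSq (P := P)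
    (Z := fun (i : {i // σ i = σ₁}) ω => inner ℝ (e i) (Y ω - a))
    (b := WithLp.toLp 2 fun i : {i // σ i = σ₁} => -inner ℝ (e i) a)
    (v := (σ₁ ^ 2).toNNReal) hk (Real.toNNReal_pos.2 (by positivity)).ne'
    ((iIndepFun_inner_sub hY hY0 he a).precomp (g := fun i : {i // σ i = σ₁} => (i : ι))
      Subtype.val_injective)
    (fun i => by simpa [i.2] using hasLaw_inner_sub hY hY0 he a i)
  rw [hv] at h
  simpa only [topSq, tsum_fintype] using h

end Bounds

/-! ### Averaging the shift inequalities over the remainder. -/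

section ProfileBounds

variable {T : Type*} [Fintype T] {b : EuclideanSpace ℝ T} {v : ℝ}

lemma gaussianNormSqDensity_of_nonpos (hT : 3 ≤ Fintype.card T) {u : ℝ} (hu : u ≤ 0) :
    gaussianNormSqDensity b v u = 0 := by
  rw [gaussianNormSqDensity, radialProfile_of_nonpos (by omega) hu, mul_zero]

lemma gaussianNormSqDensity_sub_le {u r : ℝ} (hr : 0 ≤ r) :
    gaussianNormSqDensity b v (u - r) ≤ gaussianNormSqDensity b v u * Real.exp (r / (2 * v)) := by
  rw [gaussianNormSqDensity, gaussianNormSqDensity, mul_assoc _ _ (Real.exp (r / (2 * v)))]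
  gcongr
  exact radialProfile_sub_le (fun x _ => sphereCosh_nonneg _ x) (monotoneOn_sphereCosh _) hr

lemma le_gaussianNormSqDensity_sub (hT : 3 ≤ Fintype.card T) {K u r : ℝ} (hu : 0 < u)
    (hr : 0 ≤ r) (hK : ((Fintype.card T - 2 : ℕ) : ℝ) / u + ‖v⁻¹ • b‖ / √u ≤ K) :
    gaussianNormSqDensity b v u * (Real.exp (r / (2 * v)) * (2 - Real.exp (K * r))) ≤
      gaussianNormSqDensity b v (u - r) := by
  rw [gaussianNormSqDensity, gaussianNormSqDensity, mul_assoc _ _ (_ * _)]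
  gcongr
  exact le_radialProfile_sub (by omega) (norm_nonneg _) (fun x _ => sphereCosh_nonneg _ x)
    (antitoneOn_exp_mul_sphereCosh _) hu hr hK

variable {Ω : Type*} [MeasurableSpace Ω] {P : Measure Ω} {R : Ω → ℝ}

lemma integral_gaussianNormSqDensity_le (hR0 : ∀ ω, 0 ≤ R ω) (u : ℝ)
    (hint : Integrable (fun ω => gaussianNormSqDensity b v (u - R ω)) P)
    (hexp : Integrable (fun ω => Real.exp (R ω / (2 * v))) P) :
    ∫ ω, gaussianNormSqDensity b v (u - R ω) ∂P ≤
      gaussianNormSqDensity b v u * ∫ ω, Real.exp (R ω / (2 * v)) ∂P := by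
  rw [← integral_const_mul]
  exact integral_mono hint (hexp.const_mul _) fun ω => gaussianNormSqDensity_sub_le (hR0 ω)

lemma le_integral_gaussianNormSqDensity (hT : 3 ≤ Fintype.card T) (hR0 : ∀ ω, 0 ≤ R ω) {K u : ℝ}
    (hu : 0 < u) (hK : ((Fintype.card T - 2 : ℕ) : ℝ) / u + ‖v⁻¹ • b‖ / √u ≤ K)
    (hint : Integrable (fun ω => gaussianNormSqDensity b v (u - R ω)) P)
    (hexp : Integrable (fun ω => Real.exp (R ω / (2 * v))) P)
    (hexp' : Integrable (fun ω => Real.exp ((1 / (2 * v) + K) * R ω)) P) :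
    gaussianNormSqDensity b v u * (2 * ∫ ω, Real.exp (R ω / (2 * v)) ∂P -
      ∫ ω, Real.exp ((1 / (2 * v) + K) * R ω) ∂P) ≤
      ∫ ω, gaussianNormSqDensity b v (u - R ω) ∂P := by
  rw [← integral_const_mul, ← integral_sub (hexp.const_mul 2) hexp', ← integral_const_mul]
  refine integral_mono (((hexp.const_mul 2).sub hexp').const_mul _) hint fun ω => ?_
  refine le_trans (le_of_eq ?_) (le_gaussianNormSqDensity_sub hT hu (hR0 ω) hK)
  dsimp only
  rw [add_mul, one_div_mul_eq_div, Real.exp_add]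
  ring

end ProfileBounds

/-! ### From the stated thresholds to the lower bound. -/

lemma three_threshold {u₀ u B S s : ℝ} (hB : 0 ≤ B) (hu₀ : u₀ = 2 * 3 * B) (hs : s ^ 2 = S)
    (hu : 4.9 * u₀ + 16.94 * S * u₀ ^ 2 ≤ u) : 8 * B ≤ u ∧ 64 * s ^ 2 * B ^ 2 ≤ u := by
  subst hu₀ hs
  have h : 0 ≤ s ^ 2 * B ^ 2 := by positivity
  constructor <;> nlinarith

/-- With `u₀ = 2kB`, it is enough that `(k - 2) (k - 3) ≤ (k - 1)²` and `k - 3 ≤ k`; the thresholds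
are larger than the argument needs. -/
lemma four_le_threshold {k u₀ u B S s : ℝ} (hk : 4 ≤ k) (hB : 0 ≤ B) (hu₀ : u₀ = 2 * k * B)
    (hs : s ^ 2 = S)
    (hu : 5.625 * (k - 1) ^ 2 * (k - 3)⁻¹ * u₀ + 16 * S * u₀ ^ 2 * ((k - 3) ^ 2)⁻¹ ≤ u) :
    8 * (k - 2) * B ≤ u ∧ 64 * s ^ 2 * B ^ 2 ≤ u := by
  subst hu₀ hs
  have h : 0 ≤ s ^ 2 * B ^ 2 := by positivity
  have h3 : 0 < k - 3 := by linarith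
  have e1 : 8 * (k - 2) * B ≤ 5.625 * (k - 1) ^ 2 * (k - 3)⁻¹ * (2 * k * B) := by
    have : k - 2 ≤ (k - 1) ^ 2 * (k - 3)⁻¹ := by
      rw [← div_eq_mul_inv, le_div_iff₀ h3]; nlinarith
    calc 8 * (k - 2) * B ≤ 5.625 * (2 * k) * (k - 2) * B := by
          gcongr
          · linarith
          · linarith
      _ ≤ 5.625 * (2 * k) * ((k - 1) ^ 2 * (k - 3)⁻¹) * B := by gcongr
      _ = _ := by ring
  have e2 : 64 * s ^ 2 * B ^ 2 ≤ 16 * s ^ 2 * (2 * k * B) ^ 2 * ((k - 3) ^ 2)⁻¹ := by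
    rw [← div_eq_mul_inv, le_div_iff₀ (by positivity)]
    have : (k - 3) ^ 2 ≤ k ^ 2 := by gcongr; linarith
    calc 64 * s ^ 2 * B ^ 2 * (k - 3) ^ 2 ≤ 64 * s ^ 2 * B ^ 2 * k ^ 2 := by gcongr
      _ = _ := by ring
  have h4 : 0 ≤ 64 * s ^ 2 * B ^ 2 := by positivity
  have h5 : 0 ≤ 8 * (k - 2) * B := by
    have : 0 ≤ k - 2 := by linarith
    positivity
  constructor <;> linarith

theorem lower_bound_of_thresholds {Ω : Type*} [MeasurableSpace Ω] {P : Measure Ω}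
    {H : Type*} [NormedAddCommGroup H] [InnerProductSpace ℝ H] [CompleteSpace H]
    [SecondCountableTopology H] [MeasurableSpace H] [BorelSpace H]
    {Y : Ω → H} {ι : Type*} [Countable ι] {e : HilbertBasis ι ℝ H} {σ : ι → ℝ} {σ₁ : ℝ}
    (hY : HasGaussianLaw Y P) (hY0 : ∫ ω, Y ω ∂P = 0) (he : IsCovarianceEigenbasis P Y e σ)
    [Fintype {i // σ i = σ₁}] {k : ℕ} (hσ₁ : IsTopEigenvalue σ σ₁ k)
    (hk : 3 ≤ Fintype.card {i // σ i = σ₁}) (a : H) {q : ℝ} (hq0 : 0 ≤ q) (hq : q < 1)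
    (h : ∀ j : {j // σ j ≠ σ₁}, σ j ^ 2 / σ₁ ^ 2 ≤ q)
    {b : EuclideanSpace ℝ {i // σ i = σ₁}} {u B : ℝ}
    (hB : B = ((1 - q) ^ 2)⁻¹ * ∫ ω, remainder Y e σ σ₁ a ω ∂P)
    (hint : Integrable
      (fun ω => gaussianNormSqDensity b (σ₁ ^ 2) (u - remainder Y e σ σ₁ a ω)) P)
    (h1 : 8 * ((Fintype.card {i // σ i = σ₁} : ℝ) - 2) * B ≤ u)
    (h2 : 64 * ‖(σ₁ ^ 2)⁻¹ • b‖ ^ 2 * B ^ 2 ≤ u) :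
    0.125 * gaussianNormSqDensity b (σ₁ ^ 2) u * expMoment P Y e σ σ₁ a ≤
      ∫ ω, gaussianNormSqDensity b (σ₁ ^ 2) (u - remainder Y e σ σ₁ a ω) ∂P := by
  have hpos := hσ₁.pos
  have hF := fun w => mul_nonneg (by positivity :
    0 ≤ 1 / 2 * (√(2 * Real.pi * σ₁ ^ 2))⁻¹ ^ Fintype.card {i // σ i = σ₁} *
      Real.exp (-‖b‖ ^ 2 / (2 * σ₁ ^ 2)))
    (radialProfile_nonneg (n := Fintype.card {i // σ i = σ₁} - 2) (v := σ₁ ^ 2)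
      (fun x _ => sphereCosh_nonneg ((σ₁ ^ 2)⁻¹ • b) x) w)
  -- The thresholds do not exclude `u ≤ 0`; there the top density vanishes and the bound is trivial.
  rcases le_or_gt u 0 with hu | hu
  · rw [gaussianNormSqDensity_of_nonpos hk hu]
    simpa using integral_nonneg fun ω => hF (u - remainder Y e σ σ₁ a ω)
  have hn : ((Fintype.card {i // σ i = σ₁} - 2 : ℕ) : ℝ) =
      (Fintype.card {i // σ i = σ₁} : ℝ) - 2 := by
    rw [Nat.cast_sub (by omega)]; norm_num
  have hK := threshold_bound (n := ((Fintype.card {i // σ i = σ₁} - 2 : ℕ) : ℝ)) hu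
    (by rw [hn]; exact h1) h2
  set K := ((Fintype.card {i // σ i = σ₁} - 2 : ℕ) : ℝ) / u + ‖(σ₁ ^ 2)⁻¹ • b‖ / √u with hKdef
  have hexp := (hasProd_expMoment (e := e) (σ := σ) (σ₁ := σ₁) hY hY0 he
    hσ₁ a hq h).1
  obtain ⟨hexp', hle⟩ := exp_moment_remainder_add_le (σ₁ := σ₁) hY hY0 he a
    (t := 1 / (2 * σ₁ ^ 2)) (δ := K) (q := q) (by positivity) (by positivity) hq0 hq
    (fun j => by
      have : 2 * (1 / (2 * σ₁ ^ 2)) * σ j ^ 2 = σ j ^ 2 / σ₁ ^ 2 := by field_simp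
      rw [this]; exact h j) (by rw [← hB]; exact hK)
  have hmain := le_integral_gaussianNormSqDensity hk (fun ω => restSq_nonneg e σ σ₁ (Y ω - a))
    hu hKdef.symm.le hint hexp hexp'
  simp_rw [one_div_mul_eq_div] at hle
  refine le_trans ?_ hmain
  have hu' : 0 ≤ gaussianNormSqDensity b (σ₁ ^ 2) u := hF u
  rw [expMoment, mul_comm (0.125 : ℝ), mul_assoc]
  gcongr
  simp only [remainder] at hle ⊢
  linarith

end

theorem theorem15
    {Ω : Type*} [MeasurableSpace Ω] (P : Measure Ω) [IsProbabilityMeasure P]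
    {H : Type*} [NormedAddCommGroup H] [InnerProductSpace ℝ H] [CompleteSpace H]
    [SecondCountableTopology H] [MeasurableSpace H] [BorelSpace H]
    (Y : Ω → H) (hY : HasGaussianLaw Y P) (hY0 : ∫ ω, Y ω ∂P = 0)
    {ι : Type*} (e : HilbertBasis ι ℝ H) (σ : ι → ℝ)
    (he : IsCovarianceEigenbasis P Y e σ)
    (σ₁ : ℝ) (k : ℕ) (hσ₁ : IsTopEigenvalue σ σ₁ k) (hk : 3 ≤ k) (a : H) :
    -- the expectation is finite and given by the product
    Integrable (fun ω => Real.exp (remainder Y e σ σ₁ a ω / (2 * σ₁ ^ 2))) P ∧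
    HasProd (fun j : {j // σ j ≠ σ₁} =>
      (1 - σ j ^ 2 / σ₁ ^ 2) ^ (-(1 / 2) : ℝ) *
        Real.exp ((inner ℝ (e j) a) ^ 2 / (2 * (σ₁ ^ 2 - σ j ^ 2))))
      (expMoment P Y e σ σ₁ a) ∧
    -- the continuous densities `p` of `|Y - a|²` and `f` of the sum over the top indices exist
    (∃ p, IsContinuousDensity P (fun ω => ‖Y ω - a‖ ^ 2) p) ∧
    (∃ f, IsContinuousDensity P (fun ω => topSq e σ σ₁ (Y ω - a)) f) ∧
    -- and they satisfy the two-sided bounds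
    ∀ p f : ℝ → ℝ, IsContinuousDensity P (fun ω => ‖Y ω - a‖ ^ 2) p →
      IsContinuousDensity P (fun ω => topSq e σ σ₁ (Y ω - a)) f →
      (∀ u : ℝ, 0 ≤ u → p u ≤ f u * expMoment P Y e σ σ₁ a) ∧
      (k = 3 → ∀ u : ℝ, uStar P Y e σ σ₁ k a ≤ u →
        0.125 * f u * expMoment P Y e σ σ₁ a ≤ p u) ∧
      (4 ≤ k → ∀ u : ℝ, uStarStar P Y e σ σ₁ k a ≤ u →
        0.125 * f u * expMoment P Y e σ σ₁ a ≤ p u) := by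
  have hco : Countable ι := e.orthonormal.countable_index
  have hpos := hσ₁.pos
  have hfin : {i | σ i = σ₁}.Finite := Set.finite_of_ncard_ne_zero (by
    rw [hσ₁.multiplicity]; omega)
  let _ : Fintype {i // σ i = σ₁} := hfin.fintype
  have hcard : Fintype.card {i // σ i = σ₁} = k := by
    rw [← hσ₁.multiplicity, ← Nat.card_coe_set_eq, ← Nat.card_eq_fintype_card]
    rfl
  have hk' : 3 ≤ Fintype.card {i // σ i = σ₁} := by rw [hcard]; exact hk
  have hs : Summable fun j : {j // σ j ≠ σ₁} => σ j ^ 2 :=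
    (summable_of_sum_le (f := fun j : {j // σ j ≠ σ₁} => σ j ^ 2 + (inner ℝ (e j) a) ^ 2)
      (fun _ => by positivity) (sum_le_integral_remainder hY hY0 he σ₁ a)).of_nonneg_of_le
      (fun _ => sq_nonneg _) fun j => by linarith [sq_nonneg (inner ℝ (e j) a)]
  have hn0 : 0 ≤ nextSigma σ σ₁ := nextSigma_nonneg he.nonneg
  have hq0 : 0 ≤ nextSigma σ σ₁ ^ 2 / σ₁ ^ 2 := by positivity
  have hq : nextSigma σ σ₁ ^ 2 / σ₁ ^ 2 < 1 := by
    rw [div_lt_one (by positivity)]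
    exact pow_lt_pow_left₀ (nextSigma_lt he.nonneg hσ₁ hs) hn0 (by norm_num)
  have hqj : ∀ j : {j // σ j ≠ σ₁}, σ j ^ 2 / σ₁ ^ 2 ≤ nextSigma σ σ₁ ^ 2 / σ₁ ^ 2 := by
    intro j
    have h0 := he.nonneg j
    have h1 := le_nextSigma hσ₁ j
    gcongr
  obtain ⟨hexp, hprod⟩ := hasProd_expMoment hY hY0 he hσ₁ a hq hqj
  set b : EuclideanSpace ℝ {i // σ i = σ₁} := WithLp.toLp 2 fun i => -inner ℝ (e i) a with hb
  have htop := isContinuousDensity_topSq hY hY0 he hpos hk' a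
  have hF0 : ∀ u ≤ 0, gaussianNormSqDensity b (σ₁ ^ 2) u = 0 := fun u hu =>
    gaussianNormSqDensity_of_nonpos hk' hu
  have hRm := aemeasurable_remainder (e := e) (σ := σ) hY.aemeasurable σ₁ a
  have hR0 : ∀ ω, 0 ≤ remainder Y e σ σ₁ a ω := fun ω => restSq_nonneg e σ σ₁ _
  have hnorm : IsContinuousDensity P (fun ω => ‖Y ω - a‖ ^ 2)
      (fun u => ∫ ω, gaussianNormSqDensity b (σ₁ ^ 2) (u - remainder Y e σ σ₁ a ω) ∂P) := by
    have h := htop.add_of_indepFun hF0 hRm hR0 (indepFun_topSq_remainder hY hY0 he σ₁ a)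
    simpa only [remainder, topSq_add_restSq] using h
  have hint := htop.integrable_comp_sub hF0 hRm hR0
  refine ⟨hexp, hprod, ⟨_, hnorm⟩, ⟨_, htop⟩, ?_⟩
  intro p f hp hf
  -- Continuous densities are unique, so the arbitrary `p` and `f` are the explicit ones.
  obtain rfl := hp.eq hnorm
  obtain rfl := hf.eq htop
  refine ⟨fun u _ => integral_gaussianNormSqDensity_le hR0 u (hint u) hexp, ?_, ?_⟩
  all_goals
    intro hk3 u hu
    have hB : 0 ≤ ((1 - nextSigma σ σ₁ ^ 2 / σ₁ ^ 2) ^ 2)⁻¹ *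
        ∫ ω, remainder Y e σ σ₁ a ω ∂P := mul_nonneg (by positivity) (integral_nonneg hR0)
    -- This is the origin of the factor `|a_k|² σ₁⁻⁴` in the thresholds.
    have hS : ‖(σ₁ ^ 2)⁻¹ • b‖ ^ 2 = topSq e σ σ₁ a * (σ₁ ^ 4)⁻¹ := by
      rw [norm_smul, mul_pow, norm_toLp_inner_sq, Real.norm_of_nonneg (by positivity)]
      field_simp
  · obtain ⟨h1, h2⟩ := three_threshold hB (u₀ := uZero P Y e σ σ₁ k a) (u := u)
      (by rw [uZero, hk3]; push_cast; ring) hS (by rw [uStar] at hu; linarith)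
    exact lower_bound_of_thresholds hY hY0 he hσ₁ hk' a hq0 hq hqj rfl (hint u)
      (by rw [hcard, hk3]; push_cast; linarith) h2
  · obtain ⟨h1, h2⟩ := four_le_threshold (k := k) (by exact_mod_cast hk3) hB
      (u₀ := uZero P Y e σ σ₁ k a) (u := u)
      (by rw [uZero]; ring) hS (by rw [uStarStar] at hu; linarith)
    exact lower_bound_of_thresholds hY hY0 he hσ₁ hk' a hq0 hq hqj rfl (hint u)
      (by rw [hcard]; exact h1) h2
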